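/- Let $N\ge 1$, $0<\alpha<2$, $\beta\ge 0$, $p>1$, and let $h:(0,\infty)\to(0,\infty)$ be integrable on $(0,T)$ for every $T>0$. Put $\mathcal L=-\Delta+(-\Delta)^{\alpha/2}$ on $\mathbb R^N$ and consider the problem $$\partial_t u+t^\beta\mathcal L u=-h(t)\,u^p\quad (x\in\mathbb R^N,\ t>0),\qquad u(x,0)=u_0(x)\ge 0. \tag{S1}$$ For $t>0$ let $E_\alpha(t)=P_2(t)*P_\alpha(t)$ be the heat kernel of $-\mathcal L$, where $P_2(t,x)=(4\pi t)^{-N/2}e^{-|x|^2/(4t)}$ and $P_\alpha(t,x)=(2\pi)^{-N}\int_{\mathbb R^N}e^{ix\cdot\xi-t|\xi|^\alpha}\,d\xi$, and let $E_\alpha(0)*f:=f$. For $T>0$, a mild solution of (S1) on $[0,T]$ is a bounded strongly measurable map $u:[0,T]\to L^\infty(\mathbb R^N)$ such that for every $t\in[0,T]$ and almost every $x\in\mathbb R^N$ $$u(t)=E_\alpha\Big(\tfrac{t^{\beta+1}}{\beta+1}\Big)*u_0-\int_0^t h(s)\,E_\alpha\Big(\tfrac{t^{\beta+1}}{\beta+1}-\tfrac{s^{\beta+1}}{\beta+1}\Big)*\big(|u(s)|^{p-1}u(s)\big)\,ds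 ,$$ with a convergent integral in $s$. A global mild solution is a map $u:[0,\infty)\to L^\infty(\mathbb R^N)$ that is a mild solution on $[0,T]$ for every $T>0$. Theorem (Global existence). For every $u_0\in L^\infty(\mathbb R^N)$ with $u_0\ge 0$ almost everywhere, problem (S1) has a global mild solution $u$. For all $t\ge 0$ it satisfies $u(t)\ge 0$ almost everywhere and $\|u(t)\|_{L^\infty}\le\|u_0\|_{L^\infty}$. Moreover $u\in C((0,\infty),L^\infty(\mathbb R^N))$, and $u\in C([0,\infty),L^\infty(\mathbb R^N))$ if $u_0$ coincides almost everywhere with a uniformly continuous function. The solution is unique: for every $T>0$, every mild solution of (S1) on $[0,T]$ coincides with $u$ on $[0,T]$; in particular the maximal existence time is infinite. -/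

import Mathlib

open MeasureTheory
open scoped ENNReal

namespace MixedHeat

/-- The Gauss-Weierstrass kernel `P₂(t, x) = (4πt)^(-N/2) exp(-|x|²/(4t))` on `ℝᴺ`. -/
noncomputable def gaussKernel (N : ℕ) (t : ℝ) (x : EuclideanSpace ℝ (Fin N)) : ℝ :=
  (4 * Real.pi * t) ^ (-((N : ℝ) / 2)) * Real.exp (-(‖x‖ ^ 2 / (4 * t)))

/-- The heat kernel of `-(-Δ)^(α/2)` on `ℝᴺ`, given by its Fourier representation
`P_α(t, x) = (2π)^(-N) ∫ exp(i x·ξ - t |ξ|^α) dξ`. The integral is a real number, since the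
integrand at `-ξ` is the conjugate of the integrand at `ξ`. -/
noncomputable def fracKernel (N : ℕ) (α t : ℝ) (x : EuclideanSpace ℝ (Fin N)) : ℝ :=
  ((2 * Real.pi) ^ N)⁻¹ *
    (∫ ξ : EuclideanSpace ℝ (Fin N),
      Complex.exp (Complex.I * ((inner ℝ x ξ : ℝ) : ℂ) - ((t * ‖ξ‖ ^ α : ℝ) : ℂ))).re

/-- The heat kernel `E_α(t) = P₂(t) ∗ P_α(t)` of `-𝓛 = Δ - (-Δ)^(α/2)`, for `t > 0`. -/
noncomputable def mixedKernel (N : ℕ) (α t : ℝ) (x : EuclideanSpace ℝ (Fin N)) : ℝ :=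
  ∫ y : EuclideanSpace ℝ (Fin N), gaussKernel N t (x - y) * fracKernel N α t y

open Classical in
/-- The semigroup `S(r) = exp(-r𝓛)`: `S(0) f = f`, and `S(r) f = E_α(r) ∗ f` for `r > 0`. -/
noncomputable def semigroup (N : ℕ) (α r : ℝ) (f : EuclideanSpace ℝ (Fin N) → ℝ)
    (x : EuclideanSpace ℝ (Fin N)) : ℝ :=
  if r = 0 then f x else ∫ y : EuclideanSpace ℝ (Fin N), mixedKernel N α r (x - y) * f y

/-- The time change `t ↦ t^(β+1)/(β+1)`, which turns `∂ₜ + t^β 𝓛` into `∂ₜ + 𝓛`. -/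
noncomputable def timeChange (β t : ℝ) : ℝ := t ^ (β + 1) / (β + 1)

/-- The space `L^∞(ℝᴺ)`. -/
abbrev LInf (N : ℕ) : Type := Lp ℝ ∞ (volume : Measure (EuclideanSpace ℝ (Fin N)))

/-- The integrand at time `s` and point `x` of the Duhamel term at time `t`, namely
`h(s) [E_α(t^(β+1)/(β+1) - s^(β+1)/(β+1)) ∗ (|u(s)|^(p-1) u(s))](x)`. -/
noncomputable def duhamelIntegrand (N : ℕ) (α β p : ℝ) (h : ℝ → ℝ) (u : ℝ → LInf N) (t s : ℝ)
    (x : EuclideanSpace ℝ (Fin N)) : ℝ :=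
  h s * semigroup N α (timeChange β t - timeChange β s) (fun y => |u s y| ^ (p - 1) * u s y) x

/-- `u` is a mild solution on `[0, T]`, in the class `L^∞([0, T], L^∞(ℝᴺ))`, of
`∂ₜ u + t^β 𝓛 u = -h(t) |u|^(p-1) u`, `u(0) = u₀`. Values of `u` outside `[0, T]` are
irrelevant. -/
structure IsMildSolution (N : ℕ) (α β p : ℝ) (h : ℝ → ℝ) (u₀ : LInf N) (T : ℝ)
    (u : ℝ → LInf N) : Prop where
  /-- `u` is strongly measurable in time with values in `L^∞(ℝᴺ)`. -/
  aestronglyMeasurable : AEStronglyMeasurable u (volume.restrict (Set.Icc 0 T))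
  /-- `u` is bounded in time with values in `L^∞(ℝᴺ)`. -/
  bounded : ∃ C : ℝ, ∀ t ∈ Set.Icc 0 T, ‖u t‖ ≤ C
  /-- The time integral in the Duhamel formula converges. -/
  integrable : ∀ t ∈ Set.Icc 0 T, ∀ᵐ x : EuclideanSpace ℝ (Fin N),
    IntervalIntegrable (fun s => duhamelIntegrand N α β p h u t s x) volume 0 t
  /-- The Duhamel formula; at `t = 0` it says that `u(0) = u₀`. -/
  duhamel : ∀ t ∈ Set.Icc 0 T, ∀ᵐ x : EuclideanSpace ℝ (Fin N),
    u t x = semigroup N α (timeChange β t) u₀ x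
      - ∫ s in (0 : ℝ)..t, duhamelIntegrand N α β p h u t s x

/-- A global mild solution is a mild solution on `[0, T]` for every `T > 0`. -/
def IsGlobalMildSolution (N : ℕ) (α β p : ℝ) (h : ℝ → ℝ) (u₀ : LInf N)
    (u : ℝ → LInf N) : Prop :=
  ∀ T : ℝ, 0 < T → IsMildSolution N α β p h u₀ T u

end MixedHeat

/-! The absorption term has the good sign; the work is to exploit this inside the integral equation.
Let M = ‖u₀‖, H(t) = ∫₀ᵗ h, τ(t) = t^(β+1)/(β+1), and take l above the Lipschitz constant p M^(p-1)
of the power on [0, M]. Adding l h u to both sides of the equation turns the source into h (l u -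
u^p), and x ↦ l x - x^p is nondecreasing on [0, M] with values in [0, l M]. Truncated outside [0,
M], it becomes a bounded l-Lipschitz map G on the whole line, and the shifted equation reads w(t) =
e^(-lH(t)) [S(τ(t)) u₀ + ∫₀ᵗ e^(lH(s)) h(s) S(τ(t) - τ(s)) G(w(s)) ds]. In the sup norm weighted by
e^(-2lH) the right-hand side is a contraction with constant 1/3 on all of (0, ∞), so a global
solution appears at once (`exists_shifted_mild_solution`). Positivity and contractivity of S give 0
≤ w ≤ e^(-lH)(M + (e^(lH) - 1) M) = M, so the truncation is never active. An integration by parts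
against e^(-lH) removes the shift (`mild_of_shifted_mild`). Since h is only integrable, H is only
absolutely continuous, and this calculus holds almost everywhere. Uniqueness is Gronwall's lemma for
‖v - u‖ (`eq_zero_of_le_integral`).

Everything rests on the kernel being nonnegative, of mass one, a convolution semigroup, and
continuous in L¹ for t > 0. Nonnegativity is subordination: |ξ|^α is a positive multiple of ∫ (1 -
e^(-r|ξ|²)) r^(-1-α/2) dr, so e^(-t|ξ|^α) is a limit of positive multiples of exponentials of
mixtures of Gaussians (`isPosMultiplier_exp_neg_rpow`). Nonnegativity and pairing with wide
Gaussians give integrability, Fourier inversion then gives the mass and the semigroup law, and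
Scheffé's lemma gives L¹ continuity. Hence S is continuous in operator norm on (0, ∞), and u is
continuous there for every bounded u₀. At t = 0 there is only uniform convergence S(t) g → g for
uniformly continuous g.

For t > 0 the solution lives in bounded continuous functions, where evaluation at a point is a
continuous functional; this passes from Bochner integrals to the pointwise Duhamel formula. -/

/-! ### Absolutely continuous calculus for the primitive of `h`, and Gronwall's lemma. -/

open Set Filter Topology in
theorem AbsolutelyContinuousOnInterval.lipschitzOnWith_comp {f φ : ℝ → ℝ} {a b : ℝ}
    {K : NNReal} {s : Set ℝ} (hf : AbsolutelyContinuousOnInterval f a b)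
    (hφ : LipschitzOnWith K φ s) (hs : MapsTo f (uIcc a b) s) :
    AbsolutelyContinuousOnInterval (fun x => φ (f x)) a b := by
  rw [absolutelyContinuousOnInterval_iff] at hf ⊢
  intro ε hε
  -- `K + 1` instead of `K`, which may vanish.
  obtain ⟨δ, hδ, H⟩ := hf (ε / (K + 1)) (by positivity)
  refine ⟨δ, hδ, fun E hE hlt => ?_⟩
  have h1 := H E hE hlt
  calc ∑ i ∈ Finset.range E.1, dist (φ (f (E.2 i).1)) (φ (f (E.2 i).2))
      ≤ ∑ i ∈ Finset.range E.1, K * dist (f (E.2 i).1) (f (E.2 i).2) := by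
        refine Finset.sum_le_sum fun i hi => ?_
        exact hφ.dist_le_mul _ (hs (hE.1 i hi).1) _ (hs (hE.1 i hi).2)
    _ = K * ∑ i ∈ Finset.range E.1, dist (f (E.2 i).1) (f (E.2 i).2) := by
        rw [Finset.mul_sum]
    _ ≤ (K + 1) * ∑ i ∈ Finset.range E.1, dist (f (E.2 i).1) (f (E.2 i).2) := by
        gcongr; linarith
    _ < (K + 1) * (ε / (K + 1)) := by gcongr
    _ = ε := by field_simp

namespace MixedHeat

/-- The primitive `H(t) = ∫₀ᵗ h`. -/
noncomputable def primitive (h : ℝ → ℝ) (t : ℝ) : ℝ := ∫ s in (0 : ℝ)..t, h s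

variable {h : ℝ → ℝ}

theorem primitive_absolutelyContinuous {t : ℝ} (hh : IntervalIntegrable h volume 0 t) :
    AbsolutelyContinuousOnInterval (primitive h) 0 t :=
  hh.absolutelyContinuousOnInterval_intervalIntegral (by simp)

/-- The exponential is not globally Lipschitz, but `c * primitive h` has bounded range on the
interval, and a Lipschitz constant on that range is enough. -/
theorem exp_primitive_absolutelyContinuous {t : ℝ} (hh : IntervalIntegrable h volume 0 t) (c : ℝ) :
    AbsolutelyContinuousOnInterval (fun s => Real.exp (c * primitive h s)) 0 t := by
  have h1 := (primitive_absolutelyContinuous hh).const_mul c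
  obtain ⟨C, hC⟩ := h1.exists_bound
  have h2 : ContDiffOn ℝ 1 Real.exp (Set.Icc (-C) C) := Real.contDiff_exp.contDiffOn
  obtain ⟨K, hK⟩ := h2.exists_lipschitzOnWith (by decide) (convex_Icc _ _) isCompact_Icc
  exact h1.lipschitzOnWith_comp hK fun x hx => abs_le.1 (hC x hx)

theorem ae_hasDerivAt_exp_primitive {t : ℝ} (hh : IntervalIntegrable h volume 0 t) (c : ℝ) :
    ∀ᵐ s, s ∈ Set.uIcc 0 t →
      HasDerivAt (fun s => Real.exp (c * primitive h s))
        (Real.exp (c * primitive h s) * (c * h s)) s := by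
  filter_upwards [hh.ae_hasDerivAt_integral] with s hs hst
  exact ((hs hst 0 (by simp)).const_mul c).exp

theorem integral_exp_primitive_mul {t : ℝ} (hh : IntervalIntegrable h volume 0 t) (c : ℝ) :
    ∫ s in (0 : ℝ)..t, Real.exp (c * primitive h s) * (c * h s)
      = Real.exp (c * primitive h t) - 1 := by
  have h1 := (exp_primitive_absolutelyContinuous hh c).integral_deriv_eq_sub
  simp only [primitive, intervalIntegral.integral_same, mul_zero, Real.exp_zero] at h1 ⊢
  rw [← h1]
  refine intervalIntegral.integral_congr_ae ?_
  filter_upwards [ae_hasDerivAt_exp_primitive hh c] with s hs hst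
  exact (hs (Set.uIoc_subset_uIcc hst)).deriv.symm

/-- Integration by parts against `exp (c H)`. -/
theorem integral_exp_primitive_mul_integral {t : ℝ} (hh : IntervalIntegrable h volume 0 t) (c : ℝ)
    {g : ℝ → ℝ} (hg : IntervalIntegrable g volume 0 t) :
    ∫ s in (0 : ℝ)..t, Real.exp (c * primitive h s) * (c * h s) * ∫ r in (0 : ℝ)..s, g r
      = ∫ r in (0 : ℝ)..t, (Real.exp (c * primitive h t) - Real.exp (c * primitive h r)) * g r := by
  have hE := exp_primitive_absolutelyContinuous hh c
  have h1 := hE.integral_mul_deriv_eq_deriv_mul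
    (hg.absolutelyContinuousOnInterval_intervalIntegral (c := 0) (by simp))
  have h2 : ∫ s in (0 : ℝ)..t, deriv (fun s => Real.exp (c * primitive h s)) s
        * (∫ r in (0 : ℝ)..s, g r)
      = ∫ s in (0 : ℝ)..t, Real.exp (c * primitive h s) * (c * h s) * ∫ r in (0 : ℝ)..s, g r := by
    refine intervalIntegral.integral_congr_ae ?_
    filter_upwards [ae_hasDerivAt_exp_primitive hh c] with s hs hst
    rw [(hs (Set.uIoc_subset_uIcc hst)).deriv]
  have h3 : ∫ s in (0 : ℝ)..t, Real.exp (c * primitive h s) *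
        deriv (fun s => ∫ r in (0 : ℝ)..s, g r) s
      = ∫ s in (0 : ℝ)..t, Real.exp (c * primitive h s) * g s := by
    refine intervalIntegral.integral_congr_ae ?_
    filter_upwards [hg.ae_hasDerivAt_integral] with s hs hst
    rw [(hs (Set.uIoc_subset_uIcc hst) 0 (by simp)).deriv]
  rw [h2, h3] at h1
  simp only [intervalIntegral.integral_same, mul_zero, sub_zero] at h1
  have h4 : IntervalIntegrable (fun s => Real.exp (c * primitive h s) * g s) volume 0 t :=
    hg.continuousOn_mul hE.continuousOn
  simp only [sub_mul]
  rw [intervalIntegral.integral_sub (hg.const_mul _) h4, intervalIntegral.integral_const_mul]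
  linarith

theorem primitive_nonneg (hpos : ∀ t : ℝ, 0 < t → 0 < h t) {t : ℝ} (ht : 0 ≤ t) :
    0 ≤ primitive h t := by
  rw [primitive, intervalIntegral.integral_of_le ht]
  exact setIntegral_nonneg measurableSet_Ioc fun s hs => (hpos s hs.1).le

/-- Gronwall's lemma for an integrable coefficient and a bounded unknown. -/
theorem eq_zero_of_le_integral (hpos : ∀ t : ℝ, 0 < t → 0 < h t) {T : ℝ}
    (hh : IntervalIntegrable h volume 0 T) {L C : ℝ} (hL : 0 ≤ L) {φ : ℝ → ℝ}
    (hφ0 : ∀ t ∈ Set.Icc 0 T, 0 ≤ φ t) (hφC : ∀ t ∈ Set.Icc 0 T, φ t ≤ C)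
    (hφ : ∀ t ∈ Set.Icc 0 T, φ t ≤ ∫ s in (0 : ℝ)..t, h s * (L * φ s)) :
    ∀ t ∈ Set.Icc 0 T, φ t = 0 := by
  -- The factor 2 in the exponent is the point: inserting φ ≤ A w into the integral inequality
  -- returns (A/2)(w - 1), so each pass halves the constant, and iteration from the crude bound `C`
  -- forces φ = 0.
  set w : ℝ → ℝ := fun s => Real.exp ((2 * L) * primitive h s) with hw
  have key : ∀ A : ℝ, (∀ t ∈ Set.Icc 0 T, φ t ≤ A * w t) → 
      ∀ t ∈ Set.Icc 0 T, φ t ≤ (A / 2) * w t := by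
    intro A hA t ht
    have hht : IntervalIntegrable h volume 0 t := hh.mono_set (by
      rw [Set.uIcc_of_le ht.1, Set.uIcc_of_le (ht.1.trans ht.2)]
      exact Set.Icc_subset_Icc_right ht.2)
    have hA0 : 0 ≤ A := by
      have h1 := hA t ht
      have h2 := hφ0 t ht
      by_contra hneg
      have : A * w t < 0 := mul_neg_of_neg_of_pos (not_le.1 hneg) (Real.exp_pos _)
      linarith
    have hI : IntervalIntegrable (fun s => w s * (2 * L * h s)) volume 0 t :=
      (hht.const_mul _).continuousOn_mul (exp_primitive_absolutelyContinuous hht _).continuousOn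
    calc φ t ≤ ∫ s in (0 : ℝ)..t, h s * (L * φ s) := hφ t ht
      _ ≤ ∫ s in (0 : ℝ)..t, (A / 2) * (w s * (2 * L * h s)) := by
        rw [intervalIntegral.integral_of_le ht.1, intervalIntegral.integral_of_le ht.1]
        -- This comparison asks integrability of the majorant only, so φ need not be measurable.
        refine integral_mono_of_nonneg ?_ (hI.const_mul _).1 ?_
        · refine (ae_restrict_iff' measurableSet_Ioc).2 (.of_forall fun s hs => ?_)
          have := hφ0 s ⟨hs.1.le, hs.2.trans ht.2⟩
          have := (hpos s hs.1).le
          positivity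
        · refine (ae_restrict_iff' measurableSet_Ioc).2 (.of_forall fun s hs => ?_)
          have h1 := hA s ⟨hs.1.le, hs.2.trans ht.2⟩
          have h2 := (hpos s hs.1).le
          calc h s * (L * φ s) ≤ h s * (L * (A * w s)) := by gcongr
            _ = (A / 2) * (w s * (2 * L * h s)) := by ring
      _ = (A / 2) * (w t - 1) := by
        rw [intervalIntegral.integral_const_mul, hw, integral_exp_primitive_mul hht]
      _ ≤ (A / 2) * w t := by gcongr; linarith
  have hiter : ∀ n : ℕ, ∀ t ∈ Set.Icc 0 T, φ t ≤ (C / 2 ^ n) * w t := by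
    intro n
    induction n with
    | zero =>
      intro t ht
      have hC : 0 ≤ C := (hφ0 t ht).trans (hφC t ht)
      have h1 : 1 ≤ w t := Real.one_le_exp
        (mul_nonneg (by positivity) (primitive_nonneg hpos ht.1))
      have := hφC t ht
      simp only [pow_zero, div_one]
      nlinarith
    | succ n ih =>
      intro t ht
      have := key _ ih t ht
      rwa [div_div, ← pow_succ] at this
  intro t ht
  refine le_antisymm ?_ (hφ0 t ht)
  have hlim : Filter.Tendsto (fun n : ℕ => (C / 2 ^ n) * w t) Filter.atTop (nhds (0 * w t)) := by
    refine Filter.Tendsto.mul_const _ ?_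
    exact tendsto_const_nhds.div_atTop (tendsto_pow_atTop_atTop_of_one_lt (by norm_num))
  rw [zero_mul] at hlim
  exact ge_of_tendsto' hlim fun n => hiter n t ht

end MixedHeat

/-! ### Gaussian integrals and positivity of the stable multiplier. -/

namespace MixedHeat

variable {N : ℕ}

local notation "E" => EuclideanSpace ℝ (Fin N)

theorem integral_cexp_inner_gauss {b : ℝ} (hb : 0 < b) (x : E) :
    ∫ ξ : E, Complex.exp (-(b : ℂ) * (‖ξ‖ : ℂ) ^ 2 + Complex.I * ((inner ℝ x ξ : ℝ) : ℂ))
      = (((Real.pi / b) ^ ((N : ℝ) / 2) * Real.exp (-(‖x‖ ^ 2 / (4 * b))) : ℝ) : ℂ) := by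
  have h := GaussianFourier.integral_cexp_neg_mul_sq_norm_add (V := E) (b := (b : ℂ))
    (by simpa using hb) Complex.I x
  rw [h, finrank_euclideanSpace_fin]
  push_cast
  rw [Complex.ofReal_cpow (by positivity)]
  push_cast
  congr 2
  rw [Complex.I_sq]
  ring

theorem integrable_gauss {b : ℝ} (hb : 0 < b) :
    Integrable (fun ξ : E => Real.exp (-(b * ‖ξ‖ ^ 2))) := by
  have h := (GaussianFourier.integrable_cexp_neg_mul_sq_norm_add (V := E) (b := (b : ℂ))
    (by simpa using hb) 0 0).re
  refine h.congr (.of_forall fun ξ => ?_)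
  simp only [zero_mul, add_zero]
  rw [show (-(b : ℂ) * (‖ξ‖ : ℂ) ^ 2) = ((-(b * ‖ξ‖ ^ 2) : ℝ) : ℂ) by push_cast; ring]
  exact Complex.exp_ofReal_re _

theorem integral_gauss {b : ℝ} (hb : 0 < b) :
    ∫ ξ : E, Real.exp (-(b * ‖ξ‖ ^ 2)) = (Real.pi / b) ^ ((N : ℝ) / 2) := by
  have h := GaussianFourier.integral_rexp_neg_mul_sq_norm (V := E) hb
  rw [finrank_euclideanSpace_fin] at h
  simpa [neg_mul] using h

/-- A function dominated by a Gaussian remains integrable against a bounded oscillating factor. -/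
theorem integrable_of_le_gauss {b C : ℝ} (hb : 0 < b) {f : E → ℝ} (hf : Measurable f)
    (h : ∀ ξ, |f ξ| ≤ C * Real.exp (-(b * ‖ξ‖ ^ 2))) : Integrable f :=
  ((integrable_gauss hb).const_mul C).mono' hf.aestronglyMeasurable (.of_forall h)

theorem integral_cos_inner_gauss {b : ℝ} (hb : 0 < b) (x : E) :
    ∫ ξ : E, Real.cos (inner ℝ x ξ) * Real.exp (-(b * ‖ξ‖ ^ 2))
      = (Real.pi / b) ^ ((N : ℝ) / 2) * Real.exp (-(‖x‖ ^ 2 / (4 * b))) := by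
  have h := congrArg Complex.re (integral_cexp_inner_gauss hb x)
  have hi := GaussianFourier.integrable_cexp_neg_mul_sq_norm_add (V := E) (b := (b : ℂ))
    (by simpa using hb) Complex.I x
  have h2 := integral_re (𝕜 := ℂ) hi
  simp only [RCLike.re_to_complex] at h2
  rw [← h2, Complex.ofReal_re] at h
  rw [← h]
  refine integral_congr_ae (.of_forall fun ξ => ?_)
  simp only [Complex.exp_re, Complex.add_re, Complex.mul_re, Complex.neg_re, Complex.ofReal_re,
    Complex.neg_im, Complex.ofReal_im, Complex.I_re, Complex.I_im, Complex.add_im, Complex.mul_im,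
    ← Complex.ofReal_pow]
  ring_nf

/-! ### Multipliers with nonnegative Gaussian-regularized inverse Fourier transform -/

/-- Bounded multipliers `m` such that `e^{-t|ξ|²} m(ξ)` has a nonnegative inverse Fourier
transform for every `t > 0`. -/
structure IsPosMultiplier (m : E → ℝ) : Prop where
  measurable : Measurable m
  bounded : ∃ C, ∀ ξ, |m ξ| ≤ C
  nonneg : ∀ t : ℝ, 0 < t → ∀ x : E,
    0 ≤ ∫ ξ : E, Real.cos (inner ℝ x ξ) * (Real.exp (-(t * ‖ξ‖ ^ 2)) * m ξ)

theorem IsPosMultiplier.integrable {m : E → ℝ} (hm : IsPosMultiplier m) {t : ℝ} (ht : 0 < t)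
    (x : E) :
    Integrable fun ξ : E => Real.cos (inner ℝ x ξ) * (Real.exp (-(t * ‖ξ‖ ^ 2)) * m ξ) := by
  obtain ⟨C, hC⟩ := hm.bounded
  have := hm.measurable
  refine integrable_of_le_gauss (C := C) ht (by fun_prop) fun ξ => ?_
  rw [abs_mul, abs_mul, Real.abs_exp]
  have h1 := Real.abs_cos_le_one (inner ℝ x ξ)
  calc |Real.cos (inner ℝ x ξ)| * (Real.exp (-(t * ‖ξ‖ ^ 2)) * |m ξ|)
      ≤ 1 * (Real.exp (-(t * ‖ξ‖ ^ 2)) * C) := by gcongr; exact hC ξ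
    _ = C * Real.exp (-(t * ‖ξ‖ ^ 2)) := by ring

theorem IsPosMultiplier.one : IsPosMultiplier (fun _ : E => (1 : ℝ)) where
  measurable := measurable_const
  bounded := ⟨1, fun _ => by simp⟩
  nonneg t ht x := by
    simp only [mul_one]
    rw [integral_cos_inner_gauss ht]
    positivity

theorem IsPosMultiplier.add {m m' : E → ℝ} (hm : IsPosMultiplier m) (hm' : IsPosMultiplier m') :
    IsPosMultiplier (fun ξ => m ξ + m' ξ) where
  measurable := hm.measurable.add hm'.measurable
  bounded := by
    obtain ⟨C, hC⟩ := hm.bounded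
    obtain ⟨C', hC'⟩ := hm'.bounded
    exact ⟨C + C', fun ξ => (abs_add_le _ _).trans (add_le_add (hC ξ) (hC' ξ))⟩
  nonneg t ht x := by
    simp only [mul_add]
    rw [integral_add (hm.integrable ht x) (hm'.integrable ht x)]
    exact add_nonneg (hm.nonneg t ht x) (hm'.nonneg t ht x)

theorem IsPosMultiplier.const_mul {m : E → ℝ} (hm : IsPosMultiplier m) {a : ℝ} (ha : 0 ≤ a) :
    IsPosMultiplier (fun ξ => a * m ξ) where
  measurable := hm.measurable.const_mul a
  bounded := by
    obtain ⟨C, hC⟩ := hm.bounded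
    exact ⟨a * C, fun ξ => by rw [abs_mul, abs_of_nonneg ha]; gcongr; exact hC ξ⟩
  nonneg t ht x := by
    have : ∀ ξ : E, Real.cos (inner ℝ x ξ) * (Real.exp (-(t * ‖ξ‖ ^ 2)) * (a * m ξ))
        = a * (Real.cos (inner ℝ x ξ) * (Real.exp (-(t * ‖ξ‖ ^ 2)) * m ξ)) := fun ξ => by ring
    simp only [this]
    rw [integral_const_mul]
    exact mul_nonneg ha (hm.nonneg t ht x)

theorem IsPosMultiplier.of_tendsto {m : ℕ → E → ℝ} {m' : E → ℝ} {C : ℝ}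
    (hm : ∀ n, IsPosMultiplier (m n)) (hC : ∀ n ξ, |m n ξ| ≤ C)
    (hlim : ∀ ξ, Filter.Tendsto (fun n => m n ξ) Filter.atTop (nhds (m' ξ))) :
    IsPosMultiplier m' where
  measurable := measurable_of_tendsto_metrizable (fun n => (hm n).measurable)
    (tendsto_pi_nhds.2 hlim)
  bounded := ⟨C, fun ξ => le_of_tendsto' (hlim ξ).abs fun n => hC n ξ⟩
  nonneg t ht x := by
    refine ge_of_tendsto' (tendsto_integral_of_dominated_convergence
      (F := fun n ξ => Real.cos (inner ℝ x ξ) * (Real.exp (-(t * ‖ξ‖ ^ 2)) * m n ξ))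
      (fun ξ => C * Real.exp (-(t * ‖ξ‖ ^ 2))) (fun n => ((hm n).integrable ht x).1)
      ((integrable_gauss ht).const_mul C) (fun n => .of_forall fun ξ => ?_)
      (.of_forall fun ξ => ((hlim ξ).const_mul _).const_mul _)) fun n => (hm n).nonneg t ht x
    rw [Real.norm_eq_abs, abs_mul, abs_mul, Real.abs_exp]
    have h1 := Real.abs_cos_le_one (inner ℝ x ξ)
    calc |Real.cos (inner ℝ x ξ)| * (Real.exp (-(t * ‖ξ‖ ^ 2)) * |m n ξ|)
        ≤ 1 * (Real.exp (-(t * ‖ξ‖ ^ 2)) * C) := by gcongr; exact hC n ξ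
      _ = C * Real.exp (-(t * ‖ξ‖ ^ 2)) := by ring

/-- The Laplace transform of the density `k` on `(0, ∞)`, at `|ξ|²`. -/
noncomputable def laplaceSq (k : ℝ → ℝ) (ξ : E) : ℝ :=
  ∫ r in Set.Ioi (0 : ℝ), Real.exp (-(r * ‖ξ‖ ^ 2)) * k r

section Laplace

variable {k : ℝ → ℝ} (hk : Measurable k) (hk0 : ∀ r, 0 ≤ k r)
  (hki : IntegrableOn k (Set.Ioi 0))

include hk in
theorem measurable_laplaceSq : Measurable (laplaceSq (N := N) k) := by
  have : Measurable (Function.uncurry fun (ξ : E) (r : ℝ) =>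
    Real.exp (-(r * ‖ξ‖ ^ 2)) * k r) := by
    unfold Function.uncurry
    fun_prop
  exact (this.stronglyMeasurable.integral_prod_right (ν := volume.restrict (Set.Ioi 0))).measurable

include hk0 in
theorem laplaceSq_nonneg (ξ : E) : 0 ≤ laplaceSq k ξ :=
  integral_nonneg fun r => mul_nonneg (Real.exp_pos _).le (hk0 r)

include hk hk0 hki in
theorem integrableOn_laplace (ξ : E) :
    IntegrableOn (fun r => Real.exp (-(r * ‖ξ‖ ^ 2)) * k r) (Set.Ioi 0) := by
  refine Integrable.mono' hki (by fun_prop) ?_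
  refine (ae_restrict_iff' measurableSet_Ioi).2 (.of_forall fun r hr => ?_)
  have hr : 0 < r := hr
  rw [Real.norm_eq_abs, abs_mul, Real.abs_exp, abs_of_nonneg (hk0 r)]
  exact mul_le_of_le_one_left (hk0 r) (Real.exp_le_one_iff.2 (by
    have : 0 ≤ r * ‖ξ‖ ^ 2 := by positivity
    linarith))

include hk hk0 hki in
theorem laplaceSq_le (ξ : E) : laplaceSq k ξ ≤ ∫ r in Set.Ioi (0 : ℝ), k r := by
  refine setIntegral_mono_on (integrableOn_laplace hk hk0 hki ξ) hki measurableSet_Ioi ?_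
  intro r hr
  have hr : 0 < r := hr
  exact mul_le_of_le_one_left (hk0 r) (Real.exp_le_one_iff.2 (by
    have : 0 ≤ r * ‖ξ‖ ^ 2 := by positivity
    linarith))

include hk hk0 hki in
-- A factor e^(-r|ξ|²) merely moves the regularization time from t to t + r. By Fubini the new
-- transform at time t is the integral over r of the old one at time t + r against the weight `k` ≥
-- 0.
theorem IsPosMultiplier.mul_laplaceSq {m : E → ℝ} (hm : IsPosMultiplier m) :
    IsPosMultiplier (fun ξ => m ξ * laplaceSq k ξ) where
  measurable := hm.measurable.mul (measurable_laplaceSq hk)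
  bounded := by
    obtain ⟨C, hC⟩ := hm.bounded
    refine ⟨C * ∫ r in Set.Ioi (0 : ℝ), k r, fun ξ => ?_⟩
    rw [abs_mul, abs_of_nonneg (laplaceSq_nonneg hk0 ξ)]
    have := laplaceSq_le hk hk0 hki ξ
    have := laplaceSq_nonneg hk0 ξ
    have := hC ξ
    have : 0 ≤ C := (abs_nonneg _).trans this
    gcongr
  nonneg t ht x := by
    obtain ⟨C, hC⟩ := hm.bounded
    have hmm := hm.measurable
    set F : E → ℝ → ℝ := fun ξ r =>
      (Real.cos (inner ℝ x ξ) * (Real.exp (-(t * ‖ξ‖ ^ 2)) * m ξ)) *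
        (Real.exp (-(r * ‖ξ‖ ^ 2)) * k r) with hF
    have hFm : Measurable (Function.uncurry F) := by
      simp only [hF]
      unfold Function.uncurry
      fun_prop
    have hFi : Integrable (Function.uncurry F) (volume.prod (volume.restrict (Set.Ioi 0))) := by
      have h1 : Integrable (fun z : E × ℝ => (C * Real.exp (-(t * ‖z.1‖ ^ 2))) * k z.2)
          (volume.prod (volume.restrict (Set.Ioi 0))) :=
        ((integrable_gauss ht).const_mul C).mul_prod hki
      refine h1.mono' hFm.aestronglyMeasurable ?_
      have h2 : ∀ᵐ z : E × ℝ ∂(volume.prod (volume.restrict (Set.Ioi 0))), z.2 ∈ Set.Ioi (0 : ℝ) :=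
        Measure.quasiMeasurePreserving_snd.ae (ae_restrict_mem measurableSet_Ioi)
      filter_upwards [h2] with z hz
      have hz : 0 < z.2 := hz
      simp only [Function.uncurry, hF, Real.norm_eq_abs, abs_mul, Real.abs_exp,
        abs_of_nonneg (hk0 z.2)]
      have h3 := Real.abs_cos_le_one (inner ℝ x z.1)
      have h4 : Real.exp (-(z.2 * ‖z.1‖ ^ 2)) ≤ 1 := Real.exp_le_one_iff.2 (by
        have : 0 ≤ z.2 * ‖z.1‖ ^ 2 := by positivity
        linarith)
      have h5 := hC z.1
      have h6 := hk0 z.2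
      have h7 : 0 ≤ C := (abs_nonneg _).trans h5
      calc |Real.cos (inner ℝ x z.1)| * (Real.exp (-(t * ‖z.1‖ ^ 2)) * |m z.1|) *
            (Real.exp (-(z.2 * ‖z.1‖ ^ 2)) * k z.2)
          ≤ 1 * (Real.exp (-(t * ‖z.1‖ ^ 2)) * C) * (1 * k z.2) := by gcongr
        _ = (C * Real.exp (-(t * ‖z.1‖ ^ 2))) * k z.2 := by ring
    have hswap := integral_integral_swap hFi
    have hleft : ∀ ξ : E, ∫ r in Set.Ioi (0 : ℝ), F ξ r
        = Real.cos (inner ℝ x ξ) * (Real.exp (-(t * ‖ξ‖ ^ 2)) * (m ξ * laplaceSq k ξ)) := by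
      intro ξ
      simp only [hF]
      rw [integral_const_mul, laplaceSq]
      ring
    simp only [hleft] at hswap
    rw [hswap]
    refine setIntegral_nonneg measurableSet_Ioi fun r hr => ?_
    have hr : 0 < r := hr
    have hright : ∀ ξ : E, F ξ r
        = k r * (Real.cos (inner ℝ x ξ) * (Real.exp (-((t + r) * ‖ξ‖ ^ 2)) * m ξ)) := by
      intro ξ
      simp only [hF]
      rw [show -((t + r) * ‖ξ‖ ^ 2) = -(t * ‖ξ‖ ^ 2) + -(r * ‖ξ‖ ^ 2) by ring, Real.exp_add]
      ring
    simp only [hright]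
    rw [integral_const_mul]
    exact mul_nonneg (hk0 r) (hm.nonneg (t + r) (by linarith) x)

include hk hk0 hki in
-- The exponential series has nonnegative coefficients and its powers come from iterating
-- `mul_laplaceSq`. The partial sums stay below e^(cB), so the limit may be taken.
theorem IsPosMultiplier.exp_laplaceSq {c : ℝ} (hc : 0 ≤ c) :
    IsPosMultiplier (fun ξ : E => Real.exp (c * laplaceSq k ξ)) := by
  set B := ∫ r in Set.Ioi (0 : ℝ), k r with hB
  have hpow : ∀ n : ℕ, IsPosMultiplier (fun ξ : E => (c * laplaceSq k ξ) ^ n / n.factorial) := by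
    intro n
    induction n with
    | zero => simpa using IsPosMultiplier.one
    | succ n ih =>
      have h1 := (ih.mul_laplaceSq hk hk0 hki).const_mul (a := c / (n + 1)) (by positivity)
      convert h1 using 2 with ξ
      rw [Nat.factorial_succ]
      push_cast
      field_simp
      ring
  have hsum : ∀ n : ℕ, IsPosMultiplier
      (fun ξ : E => ∑ i ∈ Finset.range n, (c * laplaceSq k ξ) ^ i / i.factorial) := by
    intro n
    induction n with
    | zero => simpa using IsPosMultiplier.one.const_mul le_rfl
    | succ n ih =>
      simp only [Finset.sum_range_succ]
      exact ih.add (hpow n)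
  refine IsPosMultiplier.of_tendsto (C := Real.exp (c * B)) hsum (fun n ξ => ?_) fun ξ => ?_
  · have h1 := laplaceSq_nonneg hk0 ξ
    rw [abs_of_nonneg (Finset.sum_nonneg fun i _ => by positivity)]
    refine (Real.sum_le_exp_of_nonneg (by positivity) n).trans ?_
    exact Real.exp_le_exp.2 (by gcongr; exact laplaceSq_le hk hk0 hki ξ)
  · rw [Real.exp_eq_exp_ℝ]
    exact (NormedSpace.expSeries_div_hasSum_exp (c * laplaceSq k ξ)).tendsto_sum_nat

end Laplace

/-! ### The stable multiplier -/

/-- Near 0 the bound 1 - e^(-r) ≤ r leaves r^(-a), integrable because a < 1; at infinity r^(-1-a) is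
integrable because a > 0. -/
theorem integrableOn_one_sub_exp_mul_rpow {a : ℝ} (ha0 : 0 < a) (ha1 : a < 1) :
    IntegrableOn (fun r : ℝ => (1 - Real.exp (-r)) * r ^ (-1 - a)) (Set.Ioi 0) := by
  have hm : Measurable (fun r : ℝ => (1 - Real.exp (-r)) * r ^ (-1 - a)) := by fun_prop
  rw [← Set.Ioc_union_Ioi_eq_Ioi zero_le_one]
  refine IntegrableOn.union ?_ ?_
  · have h1 : IntegrableOn (fun r : ℝ => r ^ (-a)) (Set.Ioc 0 1) := by
      rw [← intervalIntegrable_iff_integrableOn_Ioc_of_le zero_le_one]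
      exact intervalIntegral.intervalIntegrable_rpow' (by linarith)
    refine Integrable.mono' h1 hm.aestronglyMeasurable ?_
    refine (ae_restrict_iff' measurableSet_Ioc).2 (.of_forall fun r hr => ?_)
    have h2 : 0 ≤ 1 - Real.exp (-r) := by
      have := Real.exp_le_one_iff.2 (neg_nonpos.2 hr.1.le)
      linarith
    have h3 : 1 - Real.exp (-r) ≤ r := by
      have := Real.add_one_le_exp (-r)
      linarith
    have h4 : 0 ≤ r ^ (-1 - a) := Real.rpow_nonneg hr.1.le _
    rw [Real.norm_eq_abs, abs_of_nonneg (mul_nonneg h2 h4)]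
    calc (1 - Real.exp (-r)) * r ^ (-1 - a) ≤ r * r ^ (-1 - a) := by gcongr
      _ = r ^ (-a) := by
        rw [← Real.rpow_one_add' hr.1.le (by linarith)]
        congr 1
        ring
  · have h1 : IntegrableOn (fun r : ℝ => r ^ (-1 - a)) (Set.Ioi 1) :=
      integrableOn_Ioi_rpow_of_lt (by linarith) zero_lt_one
    refine Integrable.mono' h1 hm.aestronglyMeasurable ?_
    refine (ae_restrict_iff' measurableSet_Ioi).2 (.of_forall fun r hr => ?_)
    have hr : 1 < r := hr
    have h2 : 0 ≤ 1 - Real.exp (-r) := by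
      have := Real.exp_le_one_iff.2 (by linarith : -r ≤ 0)
      linarith
    have h4 : 0 ≤ r ^ (-1 - a) := Real.rpow_nonneg (by linarith) _
    rw [Real.norm_eq_abs, abs_of_nonneg (mul_nonneg h2 h4)]
    exact mul_le_of_le_one_left h4 (by have := Real.exp_pos (-r); linarith)

theorem integral_one_sub_exp_mul_rpow_pos {a : ℝ} (ha0 : 0 < a) (ha1 : a < 1) :
    0 < ∫ r in Set.Ioi (0 : ℝ), (1 - Real.exp (-r)) * r ^ (-1 - a) := by
  have hpos : ∀ r ∈ Set.Ioi (0 : ℝ), 0 < (1 - Real.exp (-r)) * r ^ (-1 - a) := by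
    intro r hr
    have hr : 0 < r := hr
    have h2 : Real.exp (-r) < 1 := by rw [← Real.exp_zero]; exact Real.exp_lt_exp.2 (by linarith)
    exact mul_pos (by linarith) (Real.rpow_pos_of_pos hr _)
  rw [setIntegral_pos_iff_support_of_nonneg_ae
    ((ae_restrict_iff' measurableSet_Ioi).2 (.of_forall fun r hr => (hpos r hr).le))
    (integrableOn_one_sub_exp_mul_rpow ha0 ha1)]
  have hsub : Set.Ioi (0 : ℝ) ⊆ Function.support
      fun r : ℝ => (1 - Real.exp (-r)) * r ^ (-1 - a) := fun r hr => (hpos r hr).ne'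
  rw [Set.inter_eq_right.2 hsub]
  simp

/-- The subordination formula for `l^a`. -/
theorem integral_one_sub_exp_mul_rpow {a l : ℝ} (ha0 : 0 < a) (hl : 0 ≤ l) :
    ∫ r in Set.Ioi (0 : ℝ), (1 - Real.exp (-(r * l))) * r ^ (-1 - a)
      = l ^ a * ∫ r in Set.Ioi (0 : ℝ), (1 - Real.exp (-r)) * r ^ (-1 - a) := by
  rcases hl.eq_or_lt with rfl | hl
  · simp [Real.zero_rpow ha0.ne']
  have h := integral_comp_mul_left_Ioi (fun r : ℝ => (1 - Real.exp (-r)) * r ^ (-1 - a)) 0 hl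
  rw [mul_zero] at h
  have h1 : ∫ r in Set.Ioi (0 : ℝ), (1 - Real.exp (-(l * r))) * (l * r) ^ (-1 - a)
      = l ^ (-1 - a) * ∫ r in Set.Ioi (0 : ℝ), (1 - Real.exp (-(r * l))) * r ^ (-1 - a) := by
    rw [← integral_const_mul]
    refine setIntegral_congr_fun measurableSet_Ioi fun r hr => ?_
    have hr : 0 < r := hr
    rw [Real.mul_rpow hl.le hr.le, mul_comm l r]
    ring
  rw [h1, smul_eq_mul] at h
  have h2 : l ^ (-1 - a) * (l ^ a * l) = 1 := by
    nth_rewrite 3 [← Real.rpow_one l]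
    rw [← Real.rpow_add hl, ← Real.rpow_add hl]
    ring_nf
    simp
  have h3 : l ^ (-1 - a) ≠ 0 := (Real.rpow_pos_of_pos hl _).ne'
  apply mul_left_cancel₀ h3
  rw [h]
  set c := ∫ r in Set.Ioi (0 : ℝ), (1 - Real.exp (-r)) * r ^ (-1 - a)
  calc l⁻¹ * c = (l ^ (-1 - a) * (l ^ a * l)) * (l⁻¹ * c) := by rw [h2, one_mul]
    _ = l ^ (-1 - a) * (l ^ a * c) := by field_simp

theorem integrableOn_one_sub_exp_mul_rpow_scaled {a l : ℝ} (ha0 : 0 < a) (ha1 : a < 1)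
    (hl : 0 ≤ l) :
    IntegrableOn (fun r : ℝ => (1 - Real.exp (-(r * l))) * r ^ (-1 - a)) (Set.Ioi 0) := by
  rcases hl.eq_or_lt with rfl | hl
  · simp
  have h := (integrableOn_Ioi_comp_mul_left_iff
    (fun r : ℝ => (1 - Real.exp (-r)) * r ^ (-1 - a)) 0 hl).2
    (by simpa using integrableOn_one_sub_exp_mul_rpow ha0 ha1)
  have h' : IntegrableOn (fun r => l ^ (1 + a) * ((1 - Real.exp (-(l * r))) * (l * r) ^ (-1 - a)))
      (Set.Ioi 0) := Integrable.const_mul h _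
  refine h'.congr_fun (fun r hr => ?_) measurableSet_Ioi
  have hr : 0 < r := hr
  simp only
  rw [Real.mul_rpow hl.le hr.le, mul_comm l r]
  have : l ^ (1 + a) * l ^ (-1 - a) = 1 := by
    rw [← Real.rpow_add hl]
    ring_nf
    simp
  linear_combination (1 - Real.exp (-(r * l))) * r ^ (-1 - a) * this

/-- Compound Poisson approximation. The density r^(-1-a), a = α/2, has infinite mass at 0; cut to r
> 1/(n+1) it becomes an integrable `k n`, and e^(-(t/c)(∫ k n - laplaceSq (k n))) is a positive
constant times an exponential covered by `exp_laplaceSq`. These functions are at most 1 and tend to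
e^(-t|ξ|^α) by the subordination formula. -/
theorem isPosMultiplier_exp_neg_rpow {α t : ℝ} (hα0 : 0 < α) (hα2 : α < 2) (ht : 0 ≤ t) :
    IsPosMultiplier (fun ξ : E => Real.exp (-(t * ‖ξ‖ ^ α))) := by
  set a := α / 2 with ha
  have ha0 : 0 < a := by positivity
  have ha1 : a < 1 := by rw [ha]; linarith
  set c := ∫ r in Set.Ioi (0 : ℝ), (1 - Real.exp (-r)) * r ^ (-1 - a) with hc
  have hc0 : 0 < c := integral_one_sub_exp_mul_rpow_pos ha0 ha1
  set k : ℕ → ℝ → ℝ := fun n => (Set.Ioi (1 / ((n : ℝ) + 1))).indicator fun r => r ^ (-1 - a)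
    with hk
  have hkm : ∀ n, Measurable (k n) := fun n =>
    (by fun_prop : Measurable fun r : ℝ => r ^ (-1 - a)).indicator measurableSet_Ioi
  have hk0 : ∀ n r, 0 ≤ k n r := by
    intro n r
    refine Set.indicator_nonneg (fun r hr => ?_) r
    have hr : 1 / ((n : ℝ) + 1) < r := hr
    exact Real.rpow_nonneg (le_trans (by positivity) hr.le) _
  have hki : ∀ n, IntegrableOn (k n) (Set.Ioi 0) := by
    intro n
    refine Integrable.integrableOn ?_
    rw [hk, integrable_indicator_iff measurableSet_Ioi]
    exact integrableOn_Ioi_rpow_of_lt (by linarith) (by positivity)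
  have hdiff : ∀ n (ξ : E), (∫ r in Set.Ioi (0 : ℝ), k n r) - laplaceSq (k n) ξ
      = ∫ r in Set.Ioi (0 : ℝ), (1 - Real.exp (-(r * ‖ξ‖ ^ 2))) * k n r := by
    intro n ξ
    rw [laplaceSq, ← integral_sub (hki n) (integrableOn_laplace (hkm n) (hk0 n) (hki n) ξ)]
    simp only [sub_mul, one_mul]
  have hlim : ∀ ξ : E, Filter.Tendsto
      (fun n => (∫ r in Set.Ioi (0 : ℝ), k n r) - laplaceSq (k n) ξ) Filter.atTop
      (nhds (‖ξ‖ ^ α * c)) := by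
    intro ξ
    have h1 : ‖ξ‖ ^ α = (‖ξ‖ ^ 2) ^ a := by
      rw [← Real.rpow_natCast, ← Real.rpow_mul (norm_nonneg _), ha]
      congr 1
      push_cast
      ring
    rw [h1, hc, ← integral_one_sub_exp_mul_rpow ha0 (by positivity)]
    simp only [hdiff]
    refine tendsto_integral_of_dominated_convergence
      (fun r => (1 - Real.exp (-(r * ‖ξ‖ ^ 2))) * r ^ (-1 - a)) (fun n => ?_)
      (integrableOn_one_sub_exp_mul_rpow_scaled ha0 ha1 (by positivity)) (fun n => ?_) ?_
    · have := hkm n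
      exact Measurable.aestronglyMeasurable (by fun_prop)
    · refine (ae_restrict_iff' measurableSet_Ioi).2 (.of_forall fun r hr => ?_)
      have hr : 0 < r := hr
      have h2 : 0 ≤ 1 - Real.exp (-(r * ‖ξ‖ ^ 2)) := by
        have : Real.exp (-(r * ‖ξ‖ ^ 2)) ≤ 1 := Real.exp_le_one_iff.2 (by
          have : 0 ≤ r * ‖ξ‖ ^ 2 := by positivity
          linarith)
        linarith
      rw [Real.norm_eq_abs, abs_of_nonneg (mul_nonneg h2 (hk0 n r))]
      refine mul_le_mul_of_nonneg_left ?_ h2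
      exact Set.indicator_le_self' (fun _ _ => Real.rpow_nonneg hr.le _) r
    · refine (ae_restrict_iff' measurableSet_Ioi).2 (.of_forall fun r hr => ?_)
      have hr : 0 < r := hr
      refine Filter.Tendsto.const_mul _ (tendsto_const_nhds.congr' ?_)
      have h2 := (tendsto_one_div_add_atTop_nhds_zero_nat (𝕜 := ℝ)).eventually_lt_const hr
      filter_upwards [h2] with n hn
      exact (Set.indicator_of_mem (show r ∈ Set.Ioi (1 / ((n : ℝ) + 1)) from hn)
        (fun r : ℝ => r ^ (-1 - a))).symm
  refine IsPosMultiplier.of_tendsto (C := 1) (m := fun n ξ =>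
    Real.exp (-(t / c * ∫ r in Set.Ioi (0 : ℝ), k n r)) * Real.exp (t / c * laplaceSq (k n) ξ))
    (fun n => ?_) (fun n ξ => ?_) fun ξ => ?_
  · exact (IsPosMultiplier.exp_laplaceSq (hkm n) (hk0 n) (hki n) (by positivity)).const_mul
      (Real.exp_pos _).le
  · rw [← Real.exp_add, Real.abs_exp, Real.exp_le_one_iff]
    have := laplaceSq_le (hkm n) (hk0 n) (hki n) ξ
    have h2 : 0 ≤ t / c := by positivity
    nlinarith
  · have h2 := ((hlim ξ).const_mul (t / c)).neg.rexp
    rw [show t / c * (‖ξ‖ ^ α * c) = t * ‖ξ‖ ^ α by field_simp] at h2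
    refine h2.congr fun n => ?_
    rw [← Real.exp_add]
    congr 1
    ring

end MixedHeat

/-! ### The heat kernel: positivity, integrability, mass, semigroup law. -/

namespace MixedHeat

variable {N : ℕ}

local notation "E" => EuclideanSpace ℝ (Fin N)

/-- The Fourier symbol `e^{-t(|ξ|² + |ξ|^α)}` of the semigroup. -/
noncomputable def symbol (α t : ℝ) (ξ : E) : ℝ := Real.exp (-(t * (‖ξ‖ ^ 2 + ‖ξ‖ ^ α)))

/-- The heat kernel of `-𝓛` through its Fourier representation. -/
noncomputable def heatKernel (α t : ℝ) (x : E) : ℝ :=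
  ((2 * Real.pi) ^ N)⁻¹ * ∫ ξ : E, Real.cos (inner ℝ x ξ) * symbol α t ξ

section Symbol

variable {α s t : ℝ}

@[fun_prop]
theorem measurable_symbol : Measurable (symbol (N := N) α t) := by
  unfold symbol
  fun_prop

theorem continuous_symbol (hα : 0 < α) : Continuous (symbol (N := N) α t) := by
  unfold symbol
  have : Continuous fun ξ : E => ‖ξ‖ ^ α := continuous_norm.rpow_const fun _ => Or.inr hα.le
  fun_prop

theorem symbol_pos (ξ : E) : 0 < symbol α t ξ := Real.exp_pos _

theorem symbol_le_gauss (ht : 0 ≤ t) (ξ : E) : symbol α t ξ ≤ Real.exp (-(t * ‖ξ‖ ^ 2)) := by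
  refine Real.exp_le_exp.2 (neg_le_neg ?_)
  have : 0 ≤ ‖ξ‖ ^ α := by positivity
  gcongr
  linarith

theorem symbol_le_one (ht : 0 ≤ t) (ξ : E) : symbol α t ξ ≤ 1 := by
  refine (symbol_le_gauss ht ξ).trans (Real.exp_le_one_iff.2 ?_)
  have : 0 ≤ t * ‖ξ‖ ^ 2 := by positivity
  linarith

theorem integrable_symbol (ht : 0 < t) : Integrable (symbol (N := N) α t) :=
  integrable_of_le_gauss (C := 1) ht measurable_symbol fun ξ => by
    rw [abs_of_pos (symbol_pos ξ), one_mul]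
    exact symbol_le_gauss ht.le ξ

theorem symbol_mul_symbol (ξ : E) : symbol α s ξ * symbol α t ξ = symbol α (s + t) ξ := by
  unfold symbol
  rw [← Real.exp_add]
  congr 1
  ring

theorem symbol_neg (ξ : E) : symbol α t (-ξ) = symbol α t ξ := by simp [symbol]

end Symbol

section Kernel

variable {α s t : ℝ}

/-- The Laplacian part e^(-t|ξ|²) of the symbol is exactly the Gaussian regularization built into
`IsPosMultiplier`, applied to e^(-t|ξ|^α). -/
theorem heatKernel_nonneg (hα0 : 0 < α) (hα2 : α < 2) (ht : 0 < t) (x : E) :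
    0 ≤ heatKernel α t x := by
  have h := (isPosMultiplier_exp_neg_rpow (N := N) hα0 hα2 ht.le).nonneg t ht x
  refine mul_nonneg (by positivity) (h.trans_eq (integral_congr_ae (.of_forall fun ξ => ?_)))
  simp only [symbol]
  rw [← Real.exp_add]
  congr 2
  ring

theorem heatKernel_neg (x : E) : heatKernel α t (-x) = heatKernel α t x := by
  simp [heatKernel, inner_neg_left]

theorem continuousAt_heatKernel (ht : 0 < t) (x : E) :
    ContinuousAt (fun z : ℝ × E => heatKernel α z.1 z.2) (t, x) := by
  unfold heatKernel
  refine ContinuousAt.mul continuousAt_const ?_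
  have hev : ∀ᶠ z : ℝ × E in nhds (t, x), t / 2 < z.1 :=
    continuousAt_fst.eventually (lt_mem_nhds (by simpa using by linarith))
  refine continuousAt_of_dominated (bound := fun ξ => Real.exp (-(t / 2 * ‖ξ‖ ^ 2))) ?_ ?_
    (integrable_gauss (by positivity)) ?_
  · exact .of_forall fun z => Measurable.aestronglyMeasurable (by fun_prop)
  · filter_upwards [hev] with z hz
    refine .of_forall fun ξ => ?_
    rw [Real.norm_eq_abs, abs_mul, abs_of_pos (symbol_pos ξ)]
    calc |Real.cos (inner ℝ z.2 ξ)| * symbol α z.1 ξ ≤ 1 * Real.exp (-(z.1 * ‖ξ‖ ^ 2)) := by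
          have := symbol_pos (α := α) (t := z.1) ξ
          gcongr
          · exact Real.abs_cos_le_one _
          · exact symbol_le_gauss (by linarith) ξ
      _ ≤ Real.exp (-(t / 2 * ‖ξ‖ ^ 2)) := by
          rw [one_mul]
          gcongr
  · refine .of_forall fun ξ => Continuous.continuousAt ?_
    unfold symbol
    fun_prop

theorem continuous_heatKernel (ht : 0 < t) : Continuous (heatKernel (N := N) α t) :=
  continuous_iff_continuousAt.2 fun x =>
    ContinuousAt.comp (f := fun y : E => (t, y)) (continuousAt_heatKernel ht x)
      (Continuous.continuousAt (by fun_prop))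

/-- Pairing of the heat kernel with a Gaussian. -/
theorem integral_heatKernel_mul_gauss (ht : 0 < t) {ε : ℝ} (hε : 0 < ε) :
    ∫ x : E, heatKernel α t x * Real.exp (-(ε * ‖x‖ ^ 2))
      = ((2 * Real.pi) ^ N)⁻¹ * ((Real.pi / ε) ^ ((N : ℝ) / 2) *
        ∫ ξ : E, symbol α t ξ * Real.exp (-((1 / (4 * ε)) * ‖ξ‖ ^ 2))) := by
  set F : E → E → ℝ := fun x ξ =>
    (Real.cos (inner ℝ x ξ) * symbol α t ξ) * Real.exp (-(ε * ‖x‖ ^ 2)) with hF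
  have hFi : Integrable (Function.uncurry F) (volume.prod volume) := by
    have h1 : Integrable (fun z : E × E => Real.exp (-(ε * ‖z.1‖ ^ 2)) * symbol α t z.2)
        (volume.prod volume) := (integrable_gauss hε).mul_prod (integrable_symbol ht)
    have h2 := h1.bdd_mul (c := 1) (f := fun z : E × E => Real.cos (inner ℝ z.1 z.2))
      (by fun_prop) (.of_forall fun ξ => Real.abs_cos_le_one _)
    refine h2.congr (.of_forall fun z => ?_)
    simp only [Function.uncurry, hF]
    ring
  have hswap := integral_integral_swap hFi
  have hleft : ∀ x : E, ∫ ξ : E, F x ξ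
      = (∫ ξ : E, Real.cos (inner ℝ x ξ) * symbol α t ξ) * Real.exp (-(ε * ‖x‖ ^ 2)) := fun x => by
    simp only [hF]
    rw [integral_mul_const]
  have hright : ∀ ξ : E, ∫ x : E, F x ξ = (Real.pi / ε) ^ ((N : ℝ) / 2) *
      (symbol α t ξ * Real.exp (-((1 / (4 * ε)) * ‖ξ‖ ^ 2))) := by
    intro ξ
    have h1 : ∀ x : E, F x ξ
        = symbol α t ξ * (Real.cos (inner ℝ ξ x) * Real.exp (-(ε * ‖x‖ ^ 2))) := by
      intro x
      simp only [hF]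
      rw [real_inner_comm]
      ring
    simp only [h1]
    rw [integral_const_mul, integral_cos_inner_gauss hε,
      show ‖ξ‖ ^ 2 / (4 * ε) = 1 / (4 * ε) * ‖ξ‖ ^ 2 by ring]
    ring
  simp only [hleft, hright] at hswap
  rw [integral_const_mul] at hswap
  rw [← hswap, ← integral_const_mul]
  refine integral_congr_ae (.of_forall fun x => ?_)
  simp only [heatKernel]
  ring

/-- This is the right-hand side of `integral_heatKernel_mul_gauss` with the symbol replaced by 1,
its bound and its limit as t → 0. -/
theorem gauss_normalization {ε : ℝ} (hε : 0 < ε) :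
    ((2 * Real.pi) ^ N)⁻¹ * ((Real.pi / ε) ^ ((N : ℝ) / 2) *
        ∫ ξ : E, Real.exp (-((1 / (4 * ε)) * ‖ξ‖ ^ 2))) = 1 := by
  rw [integral_gauss (by positivity), ← Real.mul_rpow (by positivity) (by positivity)]
  have h1 : Real.pi / ε * (Real.pi / (1 / (4 * ε))) = (2 * Real.pi) ^ (2 : ℝ) := by
    rw [show (2 : ℝ) = ((2 : ℕ) : ℝ) by norm_num, Real.rpow_natCast]
    field_simp
    norm_num
  rw [h1, ← Real.rpow_mul (by positivity), mul_div_cancel₀ _ (two_ne_zero), Real.rpow_natCast]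
  exact inv_mul_cancel₀ (by positivity)

theorem integral_heatKernel_mul_gauss_le (ht : 0 < t) {ε : ℝ} (hε : 0 < ε) :
    ∫ x : E, heatKernel α t x * Real.exp (-(ε * ‖x‖ ^ 2)) ≤ 1 := by
  rw [integral_heatKernel_mul_gauss ht hε]
  refine le_trans ?_ (gauss_normalization (N := N) hε).le
  have hg := integrable_gauss (N := N) (b := 1 / (4 * ε)) (by positivity)
  refine mul_le_mul_of_nonneg_left (mul_le_mul_of_nonneg_left (integral_mono ?_ hg fun ξ => ?_)
    (by positivity)) (by positivity)
  · refine hg.mono' (Measurable.aestronglyMeasurable (by fun_prop)) (.of_forall fun ξ => ?_)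
    rw [Real.norm_eq_abs, abs_mul, Real.abs_exp, abs_of_pos (symbol_pos ξ)]
    exact mul_le_of_le_one_left (Real.exp_pos _).le (symbol_le_one ht.le ξ)
  · exact mul_le_of_le_one_left (Real.exp_pos _).le (symbol_le_one ht.le ξ)

theorem heatKernel_le (ht : 0 < t) (x : E) :
    |heatKernel α t x| ≤ ((2 * Real.pi) ^ N)⁻¹ * ∫ ξ : E, symbol α t ξ := by
  rw [heatKernel, abs_mul, abs_of_pos (by positivity)]
  gcongr
  rw [← Real.norm_eq_abs]
  refine norm_integral_le_of_norm_le (integrable_symbol ht) (.of_forall fun ξ => ?_)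
  rw [Real.norm_eq_abs, abs_mul, abs_of_pos (symbol_pos ξ)]
  exact mul_le_of_le_one_left (symbol_pos ξ).le (Real.abs_cos_le_one _)

theorem integrable_heatKernel_mul_gauss (ht : 0 < t) {ε : ℝ} (hε : 0 < ε) :
    Integrable fun x : E => heatKernel α t x * Real.exp (-(ε * ‖x‖ ^ 2)) :=
  (integrable_gauss hε).bdd_mul (continuous_heatKernel ht).aestronglyMeasurable
    (.of_forall fun x => heatKernel_le ht x)

/-- On the ball of radius n + 1 the Gaussian with ε = (n+1)^(-2) is at least 1/e. As the kernel is
nonnegative, its mass on that ball is at most e times a Gaussian pairing, hence at most e for every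
n. -/
theorem integrable_heatKernel (hα0 : 0 < α) (hα2 : α < 2) (ht : 0 < t) :
    Integrable (heatKernel (N := N) α t) := by
  have hloc : ∀ n : ℕ, IntegrableOn (heatKernel (N := N) α t)
      (Metric.closedBall 0 ((n : ℝ) + 1)) := fun n =>
    (continuous_heatKernel ht).continuousOn.integrableOn_compact (isCompact_closedBall _ _)
  refine (aecover_closedBall (x := (0 : E)) (r := fun n : ℕ => (n : ℝ) + 1)
    (Filter.tendsto_atTop_add_const_right _ _ tendsto_natCast_atTop_atTop)
    ).integrable_of_integral_norm_bounded (Real.exp 1) hloc (.of_forall fun n => ?_)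
  set ε : ℝ := 1 / ((n : ℝ) + 1) ^ 2 with hε
  have hε0 : 0 < ε := by positivity
  have hi := (integrable_heatKernel_mul_gauss (N := N) (α := α) ht hε0).const_mul (Real.exp 1)
  calc ∫ x in Metric.closedBall (0 : E) ((n : ℝ) + 1), ‖heatKernel α t x‖
      ≤ ∫ x in Metric.closedBall (0 : E) ((n : ℝ) + 1),
          Real.exp 1 * (heatKernel α t x * Real.exp (-(ε * ‖x‖ ^ 2))) := by
        refine setIntegral_mono_on (hloc n).norm hi.integrableOn
          Metric.isClosed_closedBall.measurableSet fun x hx => ?_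
        have h0 := heatKernel_nonneg hα0 hα2 ht x
        have hx1 : ‖x‖ ≤ (n : ℝ) + 1 := by simpa using hx
        have h1 : ε * ‖x‖ ^ 2 ≤ 1 := by
          calc ε * ‖x‖ ^ 2 ≤ ε * ((n : ℝ) + 1) ^ 2 := by gcongr
            _ = 1 := by rw [hε]; field_simp
        have h2 : 1 ≤ Real.exp 1 * Real.exp (-(ε * ‖x‖ ^ 2)) := by
          rw [← Real.exp_add]
          exact Real.one_le_exp (by linarith)
        rw [Real.norm_eq_abs, abs_of_nonneg h0]
        nlinarith
    _ ≤ ∫ x : E, Real.exp 1 * (heatKernel α t x * Real.exp (-(ε * ‖x‖ ^ 2))) := by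
        refine setIntegral_le_integral hi (.of_forall fun x => ?_)
        have h0 := heatKernel_nonneg hα0 hα2 ht x
        simp only [Pi.zero_apply]
        positivity
    _ ≤ Real.exp 1 := by
        rw [integral_const_mul]
        exact mul_le_of_le_one_right (Real.exp_pos _).le
          (integral_heatKernel_mul_gauss_le ht hε0)

open FourierTransform in
-- The dilation by 2π converts between the phase e^(2πi x·ξ) and the normalization (2π)^(-N); the
-- imaginary part vanishes because the symbol is even.
theorem fourierInv_symbol (ht : 0 < t) (x : E) :
    𝓕⁻ (fun ξ : E => ((symbol α t ((2 * Real.pi) • ξ) : ℝ) : ℂ)) x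
      = ((heatKernel α t x : ℝ) : ℂ) := by
  have hs : Integrable fun ξ : E => symbol α t ((2 * Real.pi) • ξ) :=
    (integrable_symbol ht).comp_smul (by positivity)
  have hi : Integrable fun ξ : E => Complex.exp (((2 * Real.pi * inner ℝ ξ x : ℝ) : ℂ) * Complex.I)
      • ((symbol α t ((2 * Real.pi) • ξ) : ℝ) : ℂ) :=
    hs.ofReal.bdd_mul (c := 1) (Continuous.aestronglyMeasurable (by fun_prop))
      (.of_forall fun ξ => (Complex.norm_exp_ofReal_mul_I _).le)
  rw [Real.fourierInv_eq']
  apply Complex.ext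
  · have h := integral_re (𝕜 := ℂ) hi
    simp only [RCLike.re_to_complex] at h
    rw [← h, Complex.ofReal_re]
    have h2 := Measure.integral_comp_smul_of_nonneg volume
      (fun ξ : E => Real.cos (inner ℝ x ξ) * symbol α t ξ) (2 * Real.pi)
      (hR := by positivity)
    rw [finrank_euclideanSpace_fin, smul_eq_mul] at h2
    rw [heatKernel, ← h2]
    refine integral_congr_ae (.of_forall fun ξ => ?_)
    simp only [smul_eq_mul, Complex.re_mul_ofReal, Complex.exp_ofReal_mul_I_re, inner_smul_right]
    rw [real_inner_comm]
  · have h := integral_im (𝕜 := ℂ) hi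
    simp only [RCLike.im_to_complex] at h
    rw [← h, Complex.ofReal_im]
    simp only [smul_eq_mul, Complex.im_mul_ofReal, Complex.exp_ofReal_mul_I_im]
    have h2 := integral_neg_eq_self (fun ξ : E =>
      Real.sin (2 * Real.pi * inner ℝ ξ x) * symbol α t ((2 * Real.pi) • ξ)) volume
    simp only [inner_neg_left, mul_neg, Real.sin_neg, smul_neg, symbol_neg, neg_mul] at h2
    rw [integral_neg] at h2
    linarith

open FourierTransform in
-- Fourier inversion, available because the symbol is continuous and both it and the kernel are
-- integrable. The value at ξ = 0 is the mass of the kernel.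
theorem integral_heatKernel_mul_cos (hα0 : 0 < α) (hα2 : α < 2) (ht : 0 < t) (ξ : E) :
    ∫ x : E, heatKernel α t x * Real.cos (inner ℝ x ξ) = symbol α t ξ := by
  set f : E → ℂ := fun ξ => ((symbol α t ((2 * Real.pi) • ξ) : ℝ) : ℂ) with hf
  have hK := integrable_heatKernel (N := N) hα0 hα2 ht
  have hfc : Continuous f := by
    have := continuous_symbol (N := N) (t := t) hα0
    fun_prop
  have hfi : Integrable f := ((integrable_symbol ht).comp_smul (by positivity)).ofReal
  have hinv : 𝓕⁻ f = fun x => ((heatKernel α t x : ℝ) : ℂ) := funext fun x => fourierInv_symbol ht x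
  have hfou : Integrable (𝓕 f) := by
    have h1 : 𝓕 f = fun x => ((heatKernel α t x : ℝ) : ℂ) := by
      funext x
      have h2 := Real.fourierInv_eq_fourier_neg f (-x)
      rw [neg_neg] at h2
      rw [← h2, hinv]
      simp only [heatKernel_neg]
    rw [h1]
    exact hK.ofReal
  have h := congrFun (hfc.fourier_fourierInv_eq hfi hfou) ((2 * Real.pi)⁻¹ • ξ)
  rw [hinv, Real.fourier_eq'] at h
  have h3 := congrArg Complex.re h
  simp only [hf, Complex.ofReal_re] at h3
  rw [smul_inv_smul₀ (by positivity)] at h3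
  rw [← h3]
  have hi : Integrable fun x : E =>
      Complex.exp (((-2 * Real.pi * inner ℝ x ((2 * Real.pi)⁻¹ • ξ) : ℝ) : ℂ) * Complex.I)
      • ((heatKernel α t x : ℝ) : ℂ) :=
    hK.ofReal.bdd_mul (c := 1) (Continuous.aestronglyMeasurable (by fun_prop))
      (.of_forall fun ξ => (Complex.norm_exp_ofReal_mul_I _).le)
  have h4 := integral_re (𝕜 := ℂ) hi
  simp only [RCLike.re_to_complex] at h4
  rw [← h4]
  refine integral_congr_ae (.of_forall fun x => ?_)
  simp only [smul_eq_mul, Complex.re_mul_ofReal, Complex.exp_ofReal_mul_I_re, inner_smul_right]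
  rw [show -2 * Real.pi * ((2 * Real.pi)⁻¹ * inner ℝ x ξ) = -inner ℝ x ξ by field_simp,
    Real.cos_neg, mul_comm]

theorem integral_heatKernel (hα0 : 0 < α) (hα2 : α < 2) (ht : 0 < t) :
    ∫ x : E, heatKernel α t x = 1 := by
  have h := integral_heatKernel_mul_cos (N := N) hα0 hα2 ht 0
  simpa [symbol, Real.zero_rpow hα0.ne'] using h

theorem integral_heatKernel_mul_sin (ξ : E) :
    ∫ x : E, heatKernel α t x * Real.sin (inner ℝ x ξ) = 0 := by
  have h := integral_neg_eq_self
    (fun x : E => heatKernel α t x * Real.sin (inner ℝ x ξ)) volume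
  simp only [heatKernel_neg, inner_neg_left, Real.sin_neg, mul_neg] at h
  rw [integral_neg] at h
  linarith

/-- The semigroup property of the kernel. -/
theorem integral_heatKernel_mul_heatKernel (hα0 : 0 < α) (hα2 : α < 2) (hs : 0 < s) (ht : 0 < t)
    (x : E) : ∫ y : E, heatKernel α s (x - y) * heatKernel α t y = heatKernel α (s + t) x := by
  set F : E → E → ℝ := fun y ξ =>
    Real.cos (inner ℝ (x - y) ξ) * symbol α s ξ * heatKernel α t y with hF
  have hK := integrable_heatKernel (N := N) hα0 hα2 ht
  have hKm := (continuous_heatKernel (N := N) (α := α) ht).measurable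
  have hFi : Integrable (Function.uncurry F) (volume.prod volume) := by
    have h1 : Integrable (fun z : E × E => heatKernel α t z.1 * symbol α s z.2)
        (volume.prod volume) := hK.mul_prod (integrable_symbol hs)
    have h2 := h1.bdd_mul (c := 1) (f := fun z : E × E => Real.cos (inner ℝ (x - z.1) z.2))
      (by fun_prop) (.of_forall fun ξ => Real.abs_cos_le_one _)
    refine h2.congr (.of_forall fun z => ?_)
    simp only [Function.uncurry, hF]
    ring
  have hswap := integral_integral_swap hFi
  have hright : ∀ ξ : E, ∫ y : E, F y ξ = Real.cos (inner ℝ x ξ) * symbol α (s + t) ξ := by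
    intro ξ
    -- Addition formula for cos((x - y)·ξ): the cosine part reproduces the symbol at time t, the
    -- sine part integrates to zero by parity.
    have h1 : ∀ y : E, F y ξ
        = (Real.cos (inner ℝ x ξ) * symbol α s ξ) * (heatKernel α t y * Real.cos (inner ℝ y ξ))
          + (Real.sin (inner ℝ x ξ) * symbol α s ξ)
            * (heatKernel α t y * Real.sin (inner ℝ y ξ)) := by
      intro y
      simp only [hF, inner_sub_left, Real.cos_sub]
      ring
    have hc : Integrable fun y : E => heatKernel α t y * Real.cos (inner ℝ y ξ) :=
      hK.mul_bdd (c := 1) (by fun_prop) (.of_forall fun y => Real.abs_cos_le_one _)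
    have hsn : Integrable fun y : E => heatKernel α t y * Real.sin (inner ℝ y ξ) :=
      hK.mul_bdd (c := 1) (by fun_prop) (.of_forall fun y => Real.abs_sin_le_one _)
    simp only [h1]
    rw [integral_add (hc.const_mul _) (hsn.const_mul _), integral_const_mul, integral_const_mul,
      integral_heatKernel_mul_cos hα0 hα2 ht, integral_heatKernel_mul_sin, ← symbol_mul_symbol]
    ring
  have hleft : ∀ y : E, ∫ ξ : E, F y ξ
      = (∫ ξ : E, Real.cos (inner ℝ (x - y) ξ) * symbol α s ξ) * heatKernel α t y := by
    intro y
    simp only [hF]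
    rw [integral_mul_const]
  simp only [hleft, hright] at hswap
  rw [show heatKernel α (s + t) x = ((2 * Real.pi) ^ N)⁻¹ * ∫ ξ : E,
    Real.cos (inner ℝ x ξ) * symbol α (s + t) ξ from rfl, ← hswap, ← integral_const_mul]
  refine integral_congr_ae (.of_forall fun y => ?_)
  simp only [heatKernel]
  ring

/-- The mass of the kernel concentrates at the origin as `t → 0`. -/
theorem tendsto_integral_heatKernel_mul_gauss :
    Filter.Tendsto (fun t => ∫ x : E, heatKernel α t x * Real.exp (-‖x‖ ^ 2))
      (nhdsWithin 0 (Set.Ioi 0)) (nhds 1) := by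
  have h1 : (fun t => ((2 * Real.pi) ^ N)⁻¹ * ((Real.pi / 1) ^ ((N : ℝ) / 2) *
        ∫ ξ : E, symbol α t ξ * Real.exp (-((1 / (4 * 1)) * ‖ξ‖ ^ 2))))
      =ᶠ[nhdsWithin 0 (Set.Ioi 0)] fun t => ∫ x : E, heatKernel α t x * Real.exp (-‖x‖ ^ 2) := by
    filter_upwards [self_mem_nhdsWithin] with t ht
    have := integral_heatKernel_mul_gauss (N := N) (α := α) ht one_pos
    simp only [one_mul] at this
    rw [this]
  refine Filter.Tendsto.congr' h1 ?_
  have hnorm := gauss_normalization (N := N) one_pos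
  refine Eq.subst (motive := fun a => Filter.Tendsto _ _ (nhds a)) hnorm <|
    Filter.Tendsto.const_mul _ (Filter.Tendsto.const_mul _ ?_)
  refine tendsto_integral_filter_of_dominated_convergence
    (fun ξ : E => Real.exp (-((1 / (4 * 1)) * ‖ξ‖ ^ 2))) ?_ ?_ (integrable_gauss (by norm_num)) ?_
  · exact .of_forall fun t => Measurable.aestronglyMeasurable (by fun_prop)
  · filter_upwards [self_mem_nhdsWithin] with t ht
    refine .of_forall fun ξ => ?_
    rw [Real.norm_eq_abs, abs_mul, Real.abs_exp, abs_of_pos (symbol_pos ξ)]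
    exact mul_le_of_le_one_left (Real.exp_pos _).le (symbol_le_one (le_of_lt ht) ξ)
  · refine .of_forall fun ξ => ?_
    have h2 : Continuous fun t : ℝ => symbol α t ξ := by
      unfold symbol
      fun_prop
    have h3 : Filter.Tendsto (fun t : ℝ => symbol α t ξ * Real.exp (-((1 / (4 * 1)) * ‖ξ‖ ^ 2)))
        (nhds 0) (nhds (symbol α 0 ξ * Real.exp (-((1 / (4 * 1)) * ‖ξ‖ ^ 2)))) :=
      (h2.tendsto 0).mul_const _
    have h4 : symbol α 0 ξ = 1 := by simp [symbol]
    rw [h4, one_mul] at h3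
    exact h3.mono_left nhdsWithin_le_nhds

/-! ### Identification of `mixedKernel` with `heatKernel`. -/

theorem integrable_exp_neg_rpow (hN : 1 ≤ N) (hα : 0 < α) (ht : 0 < t) :
    Integrable fun ξ : E => Real.exp (-(t * ‖ξ‖ ^ α)) := by
  -- Integration in polar coordinates needs a nontrivial space, that is N ≥ 1.
  have : Nontrivial E := Module.nontrivial_of_finrank_pos (R := ℝ)
    (by rw [finrank_euclideanSpace_fin]; omega)
  rw [integrable_fun_norm_addHaar (f := fun r : ℝ => Real.exp (-(t * r ^ α))) volume,
    finrank_euclideanSpace_fin]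
  refine (integrableOn_rpow_mul_exp_neg_mul_rpow (s := ((N - 1 : ℕ) : ℝ)) (p := α) (b := t)
    (by have : (0 : ℝ) ≤ ((N - 1 : ℕ) : ℝ) := by positivity
        linarith) hα ht).congr_fun (fun r _ => ?_) measurableSet_Ioi
  simp only [Real.rpow_natCast, smul_eq_mul, neg_mul]

theorem fracKernel_eq (hN : 1 ≤ N) (hα : 0 < α) (ht : 0 < t) (y : E) :
    fracKernel N α t y
      = ((2 * Real.pi) ^ N)⁻¹ * ∫ ξ : E, Real.cos (inner ℝ y ξ) * Real.exp (-(t * ‖ξ‖ ^ α)) := by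
  have h0 : ∀ ξ : E, Complex.exp (Complex.I * ((inner ℝ y ξ : ℝ) : ℂ) - ((t * ‖ξ‖ ^ α : ℝ) : ℂ))
      = Complex.exp (((inner ℝ y ξ : ℝ) : ℂ) * Complex.I)
        * ((Real.exp (-(t * ‖ξ‖ ^ α)) : ℝ) : ℂ) := by
    intro ξ
    rw [Complex.ofReal_exp, ← Complex.exp_add]
    congr 1
    push_cast
    ring
  have hi : Integrable fun ξ : E => Complex.exp (((inner ℝ y ξ : ℝ) : ℂ) * Complex.I)
        * ((Real.exp (-(t * ‖ξ‖ ^ α)) : ℝ) : ℂ) :=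
    (integrable_exp_neg_rpow hN hα ht).ofReal.bdd_mul (c := 1)
      (Continuous.aestronglyMeasurable (by fun_prop))
      (.of_forall fun ξ => (Complex.norm_exp_ofReal_mul_I _).le)
  rw [fracKernel]
  simp only [h0]
  have h4 := integral_re (𝕜 := ℂ) hi
  simp only [RCLike.re_to_complex] at h4
  rw [← h4]
  simp only [Complex.re_mul_ofReal, Complex.exp_ofReal_mul_I_re]

theorem integral_gaussKernel_mul_cos (ht : 0 < t) (x ξ : E) :
    ∫ y : E, gaussKernel N t (x - y) * Real.cos (inner ℝ y ξ)
      = Real.cos (inner ℝ x ξ) * Real.exp (-(t * ‖ξ‖ ^ 2)) := by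
  have hb : 0 < 1 / (4 * t) := by positivity
  have hg : ∀ z : E, gaussKernel N t z
      = (4 * Real.pi * t) ^ (-((N : ℝ) / 2)) * Real.exp (-(1 / (4 * t) * ‖z‖ ^ 2)) := fun z => by
    rw [gaussKernel]
    congr 3
    ring
  have hi : Integrable (gaussKernel N t) := by
    simp only [funext hg]
    exact (integrable_gauss hb).const_mul _
  have hc : Integrable fun z : E => gaussKernel N t z * Real.cos (inner ℝ z ξ) :=
    hi.mul_bdd (c := 1) (by fun_prop) (.of_forall fun y => Real.abs_cos_le_one _)
  have hsn : Integrable fun z : E => gaussKernel N t z * Real.sin (inner ℝ z ξ) :=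
    hi.mul_bdd (c := 1) (by fun_prop) (.of_forall fun y => Real.abs_sin_le_one _)
  have h1 := integral_sub_left_eq_self
    (fun z : E => gaussKernel N t z * Real.cos (inner ℝ (x - z) ξ)) volume x
  simp only [sub_sub_cancel] at h1
  rw [h1]
  have h2 : ∀ z : E, gaussKernel N t z * Real.cos (inner ℝ (x - z) ξ)
      = Real.cos (inner ℝ x ξ) * (gaussKernel N t z * Real.cos (inner ℝ z ξ))
        + Real.sin (inner ℝ x ξ) * (gaussKernel N t z * Real.sin (inner ℝ z ξ)) := fun z => by
    rw [inner_sub_left, Real.cos_sub]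
    ring
  have h3 : ∫ z : E, gaussKernel N t z * Real.sin (inner ℝ z ξ) = 0 := by
    have h := integral_neg_eq_self
      (fun z : E => gaussKernel N t z * Real.sin (inner ℝ z ξ)) volume
    simp only [hg, norm_neg, inner_neg_left, Real.sin_neg, mul_neg] at h
    rw [integral_neg] at h
    simp only [hg]
    linarith
  have h4 : ∫ z : E, gaussKernel N t z * Real.cos (inner ℝ z ξ)
      = Real.exp (-(t * ‖ξ‖ ^ 2)) := by
    have h5 : ∀ z : E, gaussKernel N t z * Real.cos (inner ℝ z ξ)
        = (4 * Real.pi * t) ^ (-((N : ℝ) / 2)) *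
          (Real.cos (inner ℝ ξ z) * Real.exp (-(1 / (4 * t) * ‖z‖ ^ 2))) := fun z => by
      rw [hg, real_inner_comm]
      ring
    simp only [h5]
    rw [integral_const_mul, integral_cos_inner_gauss hb, ← mul_assoc,
      show Real.pi / (1 / (4 * t)) = 4 * Real.pi * t by field_simp,
      ← Real.rpow_add (by positivity), neg_add_cancel, Real.rpow_zero, one_mul]
    congr 2
    field_simp
  simp only [h2]
  rw [integral_add (hc.const_mul _) (hsn.const_mul _), integral_const_mul, integral_const_mul,
    h3, h4]
  ring

/-- The convolution `P₂(t) ∗ P_α(t)` is the heat kernel. -/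
theorem mixedKernel_eq (hN : 1 ≤ N) (hα : 0 < α) (ht : 0 < t) (x : E) :
    mixedKernel N α t x = heatKernel α t x := by
  set F : E → E → ℝ := fun y ξ =>
    gaussKernel N t (x - y) * (Real.cos (inner ℝ y ξ) * Real.exp (-(t * ‖ξ‖ ^ α))) with hF
  have hi : Integrable (fun y : E => gaussKernel N t (x - y)) := by
    refine Integrable.comp_sub_left (f := gaussKernel N t) ?_ x
    refine ((integrable_gauss (b := 1 / (4 * t)) (by positivity)).const_mul
      ((4 * Real.pi * t) ^ (-((N : ℝ) / 2)))).congr (.of_forall fun z => ?_)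
    simp only [gaussKernel]
    congr 3
    ring
  have hFi : Integrable (Function.uncurry F) (volume.prod volume) := by
    have h1 : Integrable (fun z : E × E =>
        gaussKernel N t (x - z.1) * Real.exp (-(t * ‖z.2‖ ^ α)))
        (volume.prod volume) := hi.mul_prod (integrable_exp_neg_rpow hN hα ht)
    have h2 := h1.bdd_mul (c := 1) (f := fun z : E × E => Real.cos (inner ℝ z.1 z.2))
      (by fun_prop) (.of_forall fun ξ => Real.abs_cos_le_one _)
    refine h2.congr (.of_forall fun z => ?_)
    simp only [Function.uncurry, hF]
    ring
  have hswap := integral_integral_swap hFi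
  have hright : ∀ ξ : E, ∫ y : E, F y ξ = Real.cos (inner ℝ x ξ) * symbol α t ξ := by
    intro ξ
    have h1 : ∀ y : E, F y ξ
        = (gaussKernel N t (x - y) * Real.cos (inner ℝ y ξ)) * Real.exp (-(t * ‖ξ‖ ^ α)) :=
      fun y => by simp only [hF]; ring
    simp only [h1]
    rw [integral_mul_const, integral_gaussKernel_mul_cos ht, symbol, mul_assoc, ← Real.exp_add]
    congr 2
    ring
  simp only [hright] at hswap
  rw [heatKernel, ← hswap, mixedKernel, ← integral_const_mul]
  refine integral_congr_ae (.of_forall fun y => ?_)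
  simp only [hF]
  rw [integral_const_mul, fracKernel_eq hN hα ht]
  ring

end Kernel

end MixedHeat

/-! ### L¹ convergence from pointwise convergence. -/

open Filter Topology in
/-- Scheffé's lemma. -/
theorem MeasureTheory.tendsto_integral_abs_sub_of_tendsto {X ι : Type*} [MeasurableSpace X]
    {μ : Measure X} {l : Filter ι} [l.IsCountablyGenerated] {k : ι → X → ℝ} {k₀ : X → ℝ}
    (hk0 : ∀ᶠ i in l, ∀ x, 0 ≤ k i x) (hki : ∀ᶠ i in l, Integrable (k i) μ)
    (hk₀ : Integrable k₀ μ) (hmass : ∀ᶠ i in l, ∫ x, k i x ∂μ = ∫ x, k₀ x ∂μ)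
    (hlim : ∀ x, Tendsto (fun i => k i x) l (𝓝 (k₀ x))) :
    Tendsto (fun i => ∫ x, |k i x - k₀ x| ∂μ) l (𝓝 0) := by
  -- Only the deficit (k₀ - k i)⁺ has an integrable majorant, namely |k₀|. Equality of the masses
  -- makes its integral half of the L¹ distance.
  have h1 : Tendsto (fun i => ∫ x, max (k₀ x - k i x) 0 ∂μ) l (𝓝 (∫ _, (0 : ℝ) ∂μ)) := by
    refine tendsto_integral_filter_of_dominated_convergence (fun x => |k₀ x|) ?_ ?_ hk₀.abs ?_
    · filter_upwards [hki] with i hi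
      exact ((hk₀.sub hi).sup (integrable_zero _ _ _)).1
    · filter_upwards [hk0] with i hi
      refine .of_forall fun x => ?_
      rw [Real.norm_eq_abs, abs_of_nonneg (le_max_right _ _)]
      exact max_le (by linarith [hi x, le_abs_self (k₀ x)]) (abs_nonneg _)
    · refine .of_forall fun x => ?_
      have : Tendsto (fun i => max (k₀ x - k i x) 0) l (𝓝 (max (k₀ x - k₀ x) 0)) :=
        (tendsto_const_nhds.sub (hlim x)).max tendsto_const_nhds
      simpa using this
  rw [integral_zero] at h1
  have h2 := h1.const_mul 2
  rw [mul_zero] at h2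
  refine h2.congr' ?_
  filter_upwards [hki, hmass] with i hi hm
  have h3 : ∀ x, |k i x - k₀ x| = 2 * max (k₀ x - k i x) 0 + (k i x - k₀ x) := by
    intro x
    rcases le_total (k₀ x) (k i x) with h | h
    · rw [abs_of_nonneg (by linarith), max_eq_right (by linarith)]; ring
    · rw [abs_of_nonpos (by linarith), max_eq_left (by linarith)]; ring
  have h4 : Integrable (fun x => 2 * max (k₀ x - k i x) 0) μ :=
    ((hk₀.sub hi).sup (integrable_zero _ _ _)).const_mul 2
  have h5 : Integrable (fun x => k i x - k₀ x) μ := hi.sub hk₀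
  simp only [h3]
  rw [integral_add h4 h5, integral_const_mul, integral_sub hi hk₀, hm]
  simp

/-! ### `L^∞`, bounded continuous functions, and their embedding. -/

namespace MixedHeat

variable {N : ℕ}

local notation "E" => EuclideanSpace ℝ (Fin N)

open scoped BoundedContinuousFunction

theorem ae_abs_le_norm (f : LInf N) : ∀ᵐ x : E, |f x| ≤ ‖f‖ := by
  have h := ae_le_eLpNormEssSup (f := (f : E → ℝ)) (μ := volume)
  filter_upwards [h] with x hx
  rw [Lp.norm_def, eLpNorm_exponent_top]
  have hfin : eLpNormEssSup (f : E → ℝ) volume ≠ ∞ := by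
    have := Lp.eLpNorm_ne_top f
    rwa [eLpNorm_exponent_top] at this
  have := (ENNReal.toReal_le_toReal enorm_ne_top hfin).2 hx
  simpa using this

theorem norm_le_of_ae_abs_le {f : LInf N} {C : ℝ} (hC : 0 ≤ C) (h : ∀ᵐ x : E, |f x| ≤ C) :
    ‖f‖ ≤ C := by
  rw [Lp.norm_def, eLpNorm_exponent_top]
  refine ENNReal.toReal_le_of_le_ofReal hC (eLpNormEssSup_le_of_ae_bound ?_)
  simpa using h

/-- The Banach space of bounded continuous functions on `ℝᴺ`. -/
def Cb (N : ℕ) : Type := EuclideanSpace ℝ (Fin N) →ᵇ ℝ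

namespace Cb

noncomputable instance : NormedAddCommGroup (Cb N) :=
  inferInstanceAs (NormedAddCommGroup (E →ᵇ ℝ))

noncomputable instance : NormedSpace ℝ (Cb N) := inferInstanceAs (NormedSpace ℝ (E →ᵇ ℝ))

instance : CompleteSpace (Cb N) := inferInstanceAs (CompleteSpace (E →ᵇ ℝ))

instance : CoeFun (Cb N) fun _ => E → ℝ := ⟨fun g => DFunLike.coe (F := E →ᵇ ℝ) g⟩

theorem continuous_coe (g : Cb N) : Continuous g := BoundedContinuousFunction.continuous (α := E) g

theorem abs_coe_le_norm (g : Cb N) (x : E) : |g x| ≤ ‖g‖ :=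
  BoundedContinuousFunction.norm_coe_le_norm (α := E) g x

theorem norm_le {g : Cb N} {C : ℝ} (hC : 0 ≤ C) (h : ∀ x, |g x| ≤ C) : ‖g‖ ≤ C :=
  (BoundedContinuousFunction.norm_le (α := E) (f := g) hC).2 h

theorem ext {f g : Cb N} (h : ∀ x, f x = g x) : f = g := BoundedContinuousFunction.ext (α := E) h

theorem add_apply (f g : Cb N) (x : E) : (f + g) x = f x + g x := rfl

theorem sub_apply (f g : Cb N) (x : E) : (f - g) x = f x - g x := rfl

theorem smul_apply (c : ℝ) (g : Cb N) (x : E) : (c • g) x = c * g x := rfl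

/-- A bounded continuous function as an element of `Cb`. -/
noncomputable def mk (f : E → ℝ) (hf : Continuous f) (C : ℝ) (hC : ∀ x, |f x| ≤ C) : Cb N :=
  BoundedContinuousFunction.ofNormedAddCommGroup f hf C hC

theorem mk_apply (f : E → ℝ) (hf : Continuous f) (C : ℝ) (hC : ∀ x, |f x| ≤ C) (x : E) :
    mk f hf C hC x = f x := rfl

/-- Evaluation at a point. -/
noncomputable def eval (x : E) : Cb N →L[ℝ] ℝ :=
  LinearMap.mkContinuous
    { toFun := fun g => g x
      map_add' := fun _ _ => rfl
      map_smul' := fun _ _ => rfl } 1 fun g => by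
    rw [one_mul]
    exact g.abs_coe_le_norm x

theorem eval_apply (x : E) (g : Cb N) : eval x g = g x := rfl

end Cb

theorem Cb.memLp_top (g : Cb N) : MemLp g ∞ (volume : Measure E) :=
  memLp_top_of_bound g.continuous_coe.aestronglyMeasurable ‖g‖ (.of_forall g.abs_coe_le_norm)

/-- The embedding of bounded continuous functions into `L^∞`. -/
noncomputable def bcfToLInf : Cb N →L[ℝ] LInf N :=
  LinearMap.mkContinuous
    { toFun := fun g => MemLp.toLp g (Cb.memLp_top g)
      map_add' := fun f g => MemLp.toLp_add (Cb.memLp_top f) (Cb.memLp_top g)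
      map_smul' := fun c g => MemLp.toLp_const_smul c (Cb.memLp_top g) } 1 fun g => by
    refine norm_le_of_ae_abs_le (by positivity) ?_
    filter_upwards [MemLp.coeFn_toLp (Cb.memLp_top g)] with x hx
    refine (congrArg abs hx).trans_le ?_
    rw [one_mul]
    exact g.abs_coe_le_norm x

theorem coeFn_bcfToLInf (g : Cb N) : (bcfToLInf g : E → ℝ) =ᵐ[volume] g :=
  MemLp.coeFn_toLp (Cb.memLp_top g)

theorem norm_bcfToLInf_le : ‖bcfToLInf (N := N)‖ ≤ 1 :=
  LinearMap.mkContinuous_norm_le _ zero_le_one _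

/-! ### Convolution with the heat kernel as an operator. -/

section Conv

variable {α s t : ℝ} (hα0 : 0 < α) (hα2 : α < 2)

/-- The convolution with the heat kernel. -/
noncomputable def heatConv (α t : ℝ) (f : E → ℝ) (x : E) : ℝ :=
  ∫ y : E, heatKernel α t (x - y) * f y

theorem semigroup_eq_heatConv (hN : 1 ≤ N) (hα : 0 < α) (ht : 0 < t) (f : E → ℝ) (x : E) :
    semigroup N α t f x = heatConv α t f x := by
  rw [semigroup, if_neg ht.ne', heatConv]
  simp only [mixedKernel_eq hN hα ht]

theorem heatConv_congr {f g : E → ℝ} (h : f =ᵐ[volume] g) (x : E) :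
    heatConv α t f x = heatConv α t g x := by
  refine integral_congr_ae ?_
  filter_upwards [h] with y hy
  rw [hy]

include hα0 hα2 in
theorem integrable_heatKernel_sub (ht : 0 < t) (x : E) :
    Integrable fun y : E => heatKernel α t (x - y) :=
  (integrable_heatKernel hα0 hα2 ht).comp_sub_left x

include hα0 hα2 in
theorem integral_heatKernel_sub (ht : 0 < t) (x : E) :
    ∫ y : E, heatKernel α t (x - y) = 1 := by
  rw [integral_sub_left_eq_self (heatKernel α t) volume x, integral_heatKernel hα0 hα2 ht]

include hα0 hα2 in
theorem integrable_heatKernel_sub_mul (ht : 0 < t) {f : E → ℝ}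
    (hf : AEStronglyMeasurable f) {M : ℝ} (hM : ∀ᵐ y, |f y| ≤ M) (x : E) :
    Integrable fun y : E => heatKernel α t (x - y) * f y :=
  (integrable_heatKernel_sub hα0 hα2 ht x).mul_bdd hf hM

include hα0 hα2 in
theorem heatConv_const (ht : 0 < t) (c : ℝ) (x : E) : heatConv α t (fun _ => c) x = c := by
  rw [heatConv, integral_mul_const, integral_heatKernel_sub hα0 hα2 ht, one_mul]

include hα0 hα2 in
theorem heatConv_sub (ht : 0 < t) {f g : E → ℝ}
    (hf : AEStronglyMeasurable f) {M : ℝ} (hfM : ∀ᵐ y, |f y| ≤ M)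
    (hg : AEStronglyMeasurable g) {M' : ℝ} (hgM : ∀ᵐ y, |g y| ≤ M') (x : E) :
    heatConv α t (fun y => f y - g y) x = heatConv α t f x - heatConv α t g x := by
  rw [heatConv, heatConv, heatConv,
    ← integral_sub (integrable_heatKernel_sub_mul hα0 hα2 ht hf hfM x)
    (integrable_heatKernel_sub_mul hα0 hα2 ht hg hgM x)]
  simp only [mul_sub]

include hα0 hα2 in
theorem abs_heatConv_le (ht : 0 < t) {f : E → ℝ}
    {M : ℝ} (hfM : ∀ᵐ y, |f y| ≤ M) (x : E) :
    |heatConv α t f x| ≤ M := by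
  rw [← heatConv_const hα0 hα2 ht M x, ← Real.norm_eq_abs]
  refine norm_integral_le_of_norm_le ((integrable_heatKernel_sub hα0 hα2 ht x).mul_const M) ?_
  filter_upwards [hfM] with y hy
  rw [Real.norm_eq_abs, abs_mul, abs_of_nonneg (heatKernel_nonneg hα0 hα2 ht _)]
  exact mul_le_mul_of_nonneg_left hy (heatKernel_nonneg hα0 hα2 ht _)

include hα0 hα2 in
-- Serves twice: with s = t it yields continuity in space of the convolution, with x = x' continuity
-- in time in operator norm.
theorem abs_heatConv_sub_heatConv_le (hs : 0 < s) (ht : 0 < t) {f : E → ℝ}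
    (hf : AEStronglyMeasurable f) {M : ℝ} (hM : ∀ᵐ y, |f y| ≤ M) (x x' : E) :
    |heatConv α s f x - heatConv α t f x'|
      ≤ (∫ y : E, |heatKernel α s (x - y) - heatKernel α t (x' - y)|) * M := by
  rw [heatConv, heatConv, ← integral_sub (integrable_heatKernel_sub_mul hα0 hα2 hs hf hM x)
    (integrable_heatKernel_sub_mul hα0 hα2 ht hf hM x'), ← Real.norm_eq_abs, ← integral_mul_const]
  refine norm_integral_le_of_norm_le (((integrable_heatKernel_sub hα0 hα2 hs x).sub
    (integrable_heatKernel_sub hα0 hα2 ht x')).abs.mul_const M) ?_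
  filter_upwards [hM] with y hy
  rw [← sub_mul, Real.norm_eq_abs, abs_mul]
  exact mul_le_mul_of_nonneg_left hy (abs_nonneg _)

include hα0 hα2 in
theorem tendsto_integral_abs_heatKernel_sub (ht : 0 < t) (x : E) :
    Filter.Tendsto (fun z : ℝ × E =>
      ∫ y : E, |heatKernel α z.1 (z.2 - y) - heatKernel α t (x - y)|) (nhds (t, x)) (nhds 0) := by
  have hev : ∀ᶠ z : ℝ × E in nhds (t, x), 0 < z.1 :=
    continuousAt_fst.eventually (lt_mem_nhds ht)
  refine tendsto_integral_abs_sub_of_tendsto ?_ ?_ (integrable_heatKernel_sub hα0 hα2 ht x) ?_ ?_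
  · filter_upwards [hev] with z hz y using heatKernel_nonneg hα0 hα2 hz _
  · filter_upwards [hev] with z hz using integrable_heatKernel_sub hα0 hα2 hz _
  · filter_upwards [hev] with z hz
    rw [integral_heatKernel_sub hα0 hα2 hz, integral_heatKernel_sub hα0 hα2 ht]
  · intro y
    exact ContinuousAt.comp (f := fun z : ℝ × E => (z.1, z.2 - y)) (x := (t, x))
      (continuousAt_heatKernel ht (x - y)) (Continuous.continuousAt (by fun_prop))

include hα0 hα2 in
theorem continuous_heatConv (ht : 0 < t) {f : E → ℝ}
    (hf : AEStronglyMeasurable f) {M : ℝ} (hM : ∀ᵐ y, |f y| ≤ M) :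
    Continuous (heatConv α t f) := by
  refine continuous_iff_continuousAt.2 fun x => ?_
  rw [ContinuousAt, tendsto_iff_norm_sub_tendsto_zero]
  have h1 := ((tendsto_integral_abs_heatKernel_sub hα0 hα2 ht x).comp
    ((Continuous.tendsto (by fun_prop : Continuous fun y : E => (t, y)) x))).mul_const M
  rw [zero_mul] at h1
  exact squeeze_zero (fun _ => norm_nonneg _)
    (fun y => abs_heatConv_sub_heatConv_le hα0 hα2 ht ht hf hM y x) h1

include hα0 hα2 in
theorem heatConv_heatConv (hs : 0 < s) (ht : 0 < t) {f : E → ℝ}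
    (hf : AEStronglyMeasurable f) {M : ℝ} (hM : ∀ᵐ y, |f y| ≤ M) (x : E) :
    heatConv α s (heatConv α t f) x = heatConv α (s + t) f x := by
  set F : E → E → ℝ := fun y z => heatKernel α s (x - y) * (heatKernel α t (y - z) * f z) with hF
  have hs' := integrable_heatKernel_sub (N := N) hα0 hα2 hs x
  have hcs := continuous_heatKernel (N := N) (α := α) hs
  have hct := continuous_heatKernel (N := N) (α := α) ht
  have hFi : Integrable (Function.uncurry F) (volume.prod volume) := by
    have hfz : AEStronglyMeasurable (fun z : E × E => f z.2) (volume.prod volume) :=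
      hf.comp_quasiMeasurePreserving Measure.quasiMeasurePreserving_snd
    have hm : AEStronglyMeasurable (Function.uncurry F) (volume.prod volume) := by
      have h1 : Continuous fun z : E × E => heatKernel α s (x - z.1) := by fun_prop
      have h2 : Continuous fun z : E × E => heatKernel α t (z.1 - z.2) := by fun_prop
      exact h1.aestronglyMeasurable.mul (h2.aestronglyMeasurable.mul hfz)
    refine (integrable_prod_iff hm).2 ⟨.of_forall fun y => ?_, ?_⟩
    · exact (integrable_heatKernel_sub_mul hα0 hα2 ht hf hM y).const_mul (heatKernel α s (x - y))
    · refine (hs'.mul_const M).mono' hm.norm.integral_prod_right' (.of_forall fun y => ?_)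
      have h3 : ∀ z : E, ‖Function.uncurry F (y, z)‖
          = heatKernel α s (x - y) * (heatKernel α t (y - z) * |f z|) := fun z => by
        simp only [Function.uncurry, hF, Real.norm_eq_abs, abs_mul]
        rw [abs_of_nonneg (heatKernel_nonneg hα0 hα2 hs _),
          abs_of_nonneg (heatKernel_nonneg hα0 hα2 ht _)]
      simp only [h3]
      rw [integral_const_mul, Real.norm_eq_abs, abs_mul,
        abs_of_nonneg (heatKernel_nonneg hα0 hα2 hs _)]
      exact mul_le_mul_of_nonneg_left (abs_heatConv_le hα0 hα2 ht (f := fun z => |f z|)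
        (by simpa using hM) y) (heatKernel_nonneg hα0 hα2 hs _)
  have hswap := integral_integral_swap hFi
  have hleft : ∀ y : E, ∫ z : E, F y z = heatKernel α s (x - y) * heatConv α t f y := fun y => by
    simp only [hF]
    rw [integral_const_mul, heatConv]
  have hright : ∀ z : E, ∫ y : E, F y z = heatKernel α (s + t) (x - z) * f z := by
    intro z
    have h1 : ∀ y : E, F y z = (heatKernel α s (x - y) * heatKernel α t (y - z)) * f z := fun y => by
      simp only [hF]; ring
    simp only [h1]
    rw [integral_mul_const, ← integral_heatKernel_mul_heatKernel hα0 hα2 hs ht]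
    congr 1
    rw [← integral_sub_right_eq_self
      (fun y : E => heatKernel α s (x - z - y) * heatKernel α t y) z]
    refine integral_congr_ae (.of_forall fun y => ?_)
    simp only [sub_sub_sub_cancel_right]
  simp only [hleft, hright] at hswap
  exact hswap

/-- The operator `S(t)` from `L^∞` to bounded continuous functions, for `t > 0`. -/
noncomputable def heatOp (t : ℝ) : LInf N →L[ℝ] Cb N :=
  if ht : 0 < t then
    LinearMap.mkContinuous
      { toFun := fun f => Cb.mk (heatConv α t f)
          (continuous_heatConv hα0 hα2 ht (Lp.aestronglyMeasurable f) (ae_abs_le_norm f)) ‖f‖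
          (fun x => abs_heatConv_le hα0 hα2 ht (ae_abs_le_norm f) x)
        map_add' := fun f g => by
          refine Cb.ext fun x => ?_
          rw [Cb.add_apply, Cb.mk_apply, Cb.mk_apply, Cb.mk_apply,
            heatConv_congr (Lp.coeFn_add f g) x, heatConv, heatConv, heatConv,
            ← integral_add (integrable_heatKernel_sub_mul hα0 hα2 ht (Lp.aestronglyMeasurable f)
              (ae_abs_le_norm f) x) (integrable_heatKernel_sub_mul hα0 hα2 ht
              (Lp.aestronglyMeasurable g) (ae_abs_le_norm g) x)]
          simp only [Pi.add_apply, mul_add]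
        map_smul' := fun c f => by
          refine Cb.ext fun x => ?_
          rw [RingHom.id_apply, Cb.smul_apply, Cb.mk_apply, Cb.mk_apply,
            heatConv_congr (Lp.coeFn_smul c f) x, heatConv, heatConv,
            ← integral_const_mul]
          refine integral_congr_ae (.of_forall fun y => ?_)
          simp only [Pi.smul_apply, smul_eq_mul]
          ring } 1
      fun f => by
        rw [one_mul]
        exact Cb.norm_le (norm_nonneg _)
          fun x => abs_heatConv_le hα0 hα2 ht (ae_abs_le_norm f) x
  -- A default value, not the identity, which does not map `L^∞` into continuous functions; it keeps
  -- the norm bound 1 valid for every t.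
  else 0

theorem heatOp_apply (ht : 0 < t) (f : LInf N) (x : E) :
    heatOp hα0 hα2 t f x = heatConv α t f x := by
  rw [heatOp, dif_pos ht]
  rfl

theorem norm_heatOp_le (t : ℝ) : ‖heatOp (N := N) hα0 hα2 t‖ ≤ 1 := by
  rw [heatOp]
  split_ifs with ht
  · exact LinearMap.mkContinuous_norm_le _ zero_le_one _
  · simp

/-- By translation invariance the L¹ distance of the two kernels seen from x does not depend on x,
so it bounds the operator norm of the difference. This makes the solution continuous at positive
times for merely bounded data. -/
theorem continuousOn_heatOp : ContinuousOn (heatOp (N := N) hα0 hα2) (Set.Ioi 0) := by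
  intro t ht
  have ht : 0 < t := ht
  refine ContinuousAt.continuousWithinAt (tendsto_iff_norm_sub_tendsto_zero.2 ?_)
  have h1 := ((tendsto_integral_abs_heatKernel_sub (N := N) hα0 hα2 ht 0).comp
    ((Continuous.tendsto (by fun_prop : Continuous fun s : ℝ => (s, (0 : E))) t)))
  refine squeeze_zero' (.of_forall fun _ => norm_nonneg _) ?_ h1
  filter_upwards [lt_mem_nhds ht] with s hs
  refine ContinuousLinearMap.opNorm_le_bound _ (integral_nonneg fun _ => abs_nonneg _) fun f => ?_
  refine Cb.norm_le (mul_nonneg (integral_nonneg fun _ => abs_nonneg _) (norm_nonneg _))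
    fun x => ?_
  rw [sub_apply, Cb.sub_apply, heatOp_apply _ _ hs, heatOp_apply _ _ ht]
  refine (abs_heatConv_sub_heatConv_le hα0 hα2 hs ht (Lp.aestronglyMeasurable f)
    (ae_abs_le_norm f) x x).trans_eq ?_
  congr 1
  rw [integral_sub_left_eq_self (fun y : E => |heatKernel α s y - heatKernel α t y|) volume x]
  exact (integral_sub_left_eq_self (fun y : E => |heatKernel α s y - heatKernel α t y|) volume
    0).symm

theorem heatOp_bcfToLInf_heatOp (hs : 0 < s) (ht : 0 < t) (f : LInf N) :
    heatOp hα0 hα2 s (bcfToLInf (heatOp hα0 hα2 t f)) = heatOp hα0 hα2 (s + t) f := by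
  refine Cb.ext fun x => ?_
  rw [heatOp_apply _ _ hs, heatOp_apply _ _ (add_pos hs ht), heatConv_congr (coeFn_bcfToLInf _),
    ← heatConv_heatConv hα0 hα2 hs ht (Lp.aestronglyMeasurable f) (ae_abs_le_norm f)]
  simp only [heatConv, heatOp_apply _ _ ht]

include hα0 hα2 in
/-- Uniform convergence of `S(t) g` to a bounded uniformly continuous `g` as `t → 0`. -/
theorem exists_forall_abs_heatConv_sub_le {g : E → ℝ} (hg : UniformContinuous g) {M : ℝ}
    (hM : ∀ x, |g x| ≤ M) {ε : ℝ} (hε : 0 < ε) :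
    ∀ᶠ t in nhdsWithin (0 : ℝ) (Set.Ioi 0), ∀ x : E, |heatConv α t g x - g x| ≤ ε := by
  obtain ⟨δ, hδ, hδg⟩ := Metric.uniformContinuous_iff.1 hg (ε / 2) (by positivity)
  have hM0 : 0 ≤ M := (abs_nonneg _).trans (hM 0)
  -- For ‖z‖ ≥ δ one has 1 ≤ (1 - e^(-‖z‖²))/c, so the kernel mass away from the origin is
  -- controlled by one minus its pairing with e^(-‖z‖²), which tends to 0.
  set c : ℝ := 1 - Real.exp (-δ ^ 2) with hc
  have hc0 : 0 < c := by
    have : Real.exp (-δ ^ 2) < 1 := by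
      rw [← Real.exp_zero]
      exact Real.exp_lt_exp.2 (by have := pow_pos hδ 2; linarith)
    rw [hc]
    linarith
  have hlim := (((tendsto_integral_heatKernel_mul_gauss (N := N) (α := α)).const_sub
    1).const_mul (2 * M / c)).const_add (ε / 2)
  rw [sub_self, mul_zero, add_zero] at hlim
  filter_upwards [hlim.eventually_le_const (by linarith : ε / 2 < ε), self_mem_nhdsWithin]
    with t hle ht x
  have ht : 0 < t := ht
  refine le_trans ?_ hle
  have hK := integrable_heatKernel (N := N) hα0 hα2 ht
  have hKg : Integrable fun z : E => heatKernel α t z * Real.exp (-‖z‖ ^ 2) := by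
    simpa using integrable_heatKernel_mul_gauss (N := N) (α := α) ht one_pos
  have hsm := hg.continuous.aestronglyMeasurable (μ := (volume : Measure E))
  rw [← heatConv_const hα0 hα2 ht (g x) x, ← heatConv_sub hα0 hα2 ht hsm (.of_forall hM)
    aestronglyMeasurable_const (.of_forall fun _ => le_rfl), heatConv,
    ← integral_sub_left_eq_self (fun y : E => heatKernel α t (x - y) * (g y - g x)) volume x,
    ← Real.norm_eq_abs]
  have hb : Integrable fun z : E => (ε / 2) * heatKernel α t z
      + (2 * M / c) * (heatKernel α t z - heatKernel α t z * Real.exp (-‖z‖ ^ 2)) :=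
    (hK.const_mul _).add ((hK.sub hKg).const_mul _)
  refine (norm_integral_le_of_norm_le hb (.of_forall fun z => ?_)).trans_eq ?_
  · have h0 := heatKernel_nonneg hα0 hα2 ht z
    rw [sub_sub_cancel, norm_mul, Real.norm_eq_abs, abs_of_nonneg h0, Real.norm_eq_abs]
    have h1 : Real.exp (-‖z‖ ^ 2) ≤ 1 := Real.exp_le_one_iff.2 (by
      have := pow_nonneg (norm_nonneg z) 2
      linarith)
    have h2 : |g (x - z) - g x| ≤ ε / 2 + 2 * M / c * (1 - Real.exp (-‖z‖ ^ 2)) := by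
      have h3 : 0 ≤ 2 * M / c := by positivity
      by_cases hz : ‖z‖ < δ
      · have h4 := hδg (a := x - z) (b := x) (by simpa [dist_eq_norm] using hz)
        rw [Real.dist_eq] at h4
        have : 0 ≤ 2 * M / c * (1 - Real.exp (-‖z‖ ^ 2)) := mul_nonneg h3 (by linarith)
        linarith
      · have h4 : c ≤ 1 - Real.exp (-‖z‖ ^ 2) := by
          have : Real.exp (-‖z‖ ^ 2) ≤ Real.exp (-δ ^ 2) :=
            Real.exp_le_exp.2 (by
              have := pow_le_pow_left₀ hδ.le (not_lt.1 hz) 2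
              linarith)
          rw [hc]
          linarith
        have h5 : 2 * M ≤ 2 * M / c * (1 - Real.exp (-‖z‖ ^ 2)) := by
          calc 2 * M = 2 * M / c * c := by field_simp
            _ ≤ _ := by gcongr
        have h6 := abs_sub (g (x - z)) (g x)
        have h7 := hM (x - z)
        have h8 := hM x
        linarith
    calc heatKernel α t z * |g (x - z) - g x|
        ≤ heatKernel α t z * (ε / 2 + 2 * M / c * (1 - Real.exp (-‖z‖ ^ 2))) := by gcongr
      _ = _ := by ring
  · have hd : Integrable fun z : E =>
        2 * M / c * (heatKernel α t z - heatKernel α t z * Real.exp (-‖z‖ ^ 2)) :=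
      (hK.sub hKg).const_mul _
    rw [integral_add (hK.const_mul _) hd, integral_const_mul,
      integral_const_mul, integral_sub hK hKg, integral_heatKernel hα0 hα2 ht, mul_one]

end Conv

end MixedHeat

/-! ### Evolution families and their Duhamel integrals. -/

namespace MixedHeat

/-- A contractive evolution family `V t s`, `0 < s < t`, continuous in operator norm off the
diagonal. -/
structure EvolutionFamily (A : Type*) [NormedAddCommGroup A] [NormedSpace ℝ A] where
  /-- The propagator from time `s` to time `t`. -/
  V : ℝ → ℝ → A →L[ℝ] A
  norm_le : ∀ t s, ‖V t s‖ ≤ 1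
  continuousOn : ContinuousOn (fun z : ℝ × ℝ => V z.1 z.2) {z | 0 < z.2 ∧ z.2 < z.1}
  comp : ∀ r s t, 0 < r → r < s → s < t → ∀ a, V t s (V s r a) = V t r a

namespace EvolutionFamily

variable {A : Type*} [NormedAddCommGroup A] [NormedSpace ℝ A] (𝒱 : EvolutionFamily A)
  {k : ℝ → ℝ} {g : ℝ → A} {B : ℝ}

theorem norm_apply_le (t s : ℝ) (a : A) : ‖𝒱.V t s a‖ ≤ ‖a‖ := by
  simpa using (𝒱.V t s).le_of_opNorm_le (𝒱.norm_le t s) a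

theorem continuousOn_apply (hg : ContinuousOn g (Set.Ioi 0)) (t : ℝ) :
    ContinuousOn (fun s => 𝒱.V t s (g s)) (Set.Ioo 0 t) := by
  have h1 : ContinuousOn (fun s => 𝒱.V t s) (Set.Ioo 0 t) :=
    𝒱.continuousOn.comp (by fun_prop : Continuous fun s : ℝ => (t, s)).continuousOn
      fun s hs => ⟨hs.1, hs.2⟩
  exact h1.clm_apply (hg.mono fun s hs => hs.1)

theorem intervalIntegrable {t : ℝ} (ht : 0 < t) (hk : IntervalIntegrable k volume 0 t)
    (hg : ContinuousOn g (Set.Ioi 0)) (hB : ∀ s, 0 < s → ‖g s‖ ≤ B) :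
    IntervalIntegrable (fun s => k s • 𝒱.V t s (g s)) volume 0 t := by
  rw [intervalIntegrable_iff_integrableOn_Ioo_of_le ht.le] at hk ⊢
  refine (hk.norm.mul_const B).mono' (hk.aestronglyMeasurable.smul
    ((𝒱.continuousOn_apply hg t).aestronglyMeasurable measurableSet_Ioo)) ?_
  refine (ae_restrict_iff' measurableSet_Ioo).2 (.of_forall fun s hs => ?_)
  rw [norm_smul]
  exact mul_le_mul_of_nonneg_left ((𝒱.norm_apply_le t s _).trans (hB s hs.1)) (norm_nonneg _)

theorem norm_integral_le {t : ℝ} (ht : 0 < t)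
    (hk0 : ∀ s, 0 < s → 0 ≤ k s) {b : ℝ → ℝ}
    (hkb : IntervalIntegrable (fun s => k s * b s) volume 0 t) (hb : ∀ s, 0 < s → ‖g s‖ ≤ b s) :
    ‖∫ s in (0 : ℝ)..t, k s • 𝒱.V t s (g s)‖ ≤ ∫ s in (0 : ℝ)..t, k s * b s := by
  refine intervalIntegral.norm_integral_le_of_norm_le ht.le (.of_forall fun s hs => ?_) hkb
  rw [norm_smul, Real.norm_eq_abs, abs_of_nonneg (hk0 s hs.1)]
  exact mul_le_mul_of_nonneg_left ((𝒱.norm_apply_le t s _).trans (hb s hs.1)) (hk0 s hs.1)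

open Filter Topology in
/-- The Duhamel integral is continuous in time. -/
theorem continuousOn_integral (hk : ∀ t, 0 < t → IntervalIntegrable k volume 0 t)
    (hg : ContinuousOn g (Set.Ioi 0)) (hB : ∀ s, 0 < s → ‖g s‖ ≤ B) :
    ContinuousOn (fun t => ∫ s in (0 : ℝ)..t, k s • 𝒱.V t s (g s)) (Set.Ioi 0) := by
  intro t₀ ht₀
  have ht₀ : 0 < t₀ := ht₀
  refine ContinuousAt.continuousWithinAt ?_
  set T := t₀ + 1 with hT
  -- The indicator of s < t puts all integrals on the fixed interval (0, T). The integrand then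
  -- converges for every s ≠ t₀, so nothing is needed about `V` on the diagonal.
  set F : ℝ → ℝ → A := fun t => (Set.Iio t).indicator fun s => k s • 𝒱.V t s (g s) with hF
  have hFt : ∀ t ∈ Set.Ioo 0 T, ∫ s in Set.Ioo 0 T, F t s
      = ∫ s in (0 : ℝ)..t, k s • 𝒱.V t s (g s) := by
    intro t ht
    rw [intervalIntegral.integral_of_le ht.1.le, integral_Ioc_eq_integral_Ioo,
      integral_indicator measurableSet_Iio, Measure.restrict_restrict measurableSet_Iio]
    congr 2
    ext s
    simp only [Set.mem_inter_iff, Set.mem_Iio, Set.mem_Ioo]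
    exact ⟨fun h => ⟨h.2.1, h.1⟩, fun h => ⟨h.2, h.1, h.2.trans ht.2⟩⟩
  have hnhds : Set.Ioo 0 T ∈ 𝓝 t₀ := Ioo_mem_nhds ht₀ (by rw [hT]; linarith)
  have hkT := hk T (by rw [hT]; linarith)
  rw [intervalIntegrable_iff_integrableOn_Ioo_of_le (by rw [hT]; linarith)] at hkT
  rw [ContinuousAt, ← hFt t₀ (mem_of_mem_nhds hnhds)]
  refine Tendsto.congr' (f₁ := fun t => ∫ s in Set.Ioo 0 T, F t s)
    (by filter_upwards [hnhds] with t ht using hFt t ht) ?_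
  refine tendsto_integral_filter_of_dominated_convergence (fun s => ‖k s‖ * B) ?_ ?_
    (hkT.norm.mul_const B) ?_
  · filter_upwards [hnhds] with t ht
    rw [hF, aestronglyMeasurable_indicator_iff measurableSet_Iio,
      Measure.restrict_restrict measurableSet_Iio]
    have h1 : Set.Iio t ∩ Set.Ioo 0 T = Set.Ioo 0 t := by
      ext s
      simp only [Set.mem_inter_iff, Set.mem_Iio, Set.mem_Ioo]
      exact ⟨fun h => ⟨h.2.1, h.1⟩, fun h => ⟨h.2, h.1, h.2.trans ht.2⟩⟩
    rw [h1]
    have h2 := 𝒱.intervalIntegrable ht.1 (hk t ht.1) hg hB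
    rw [intervalIntegrable_iff_integrableOn_Ioo_of_le ht.1.le] at h2
    exact h2.aestronglyMeasurable
  · refine .of_forall fun t => (ae_restrict_iff' measurableSet_Ioo).2 (.of_forall fun s hs => ?_)
    refine (norm_indicator_le_norm_self _ _).trans ?_
    rw [norm_smul]
    exact mul_le_mul_of_nonneg_left ((𝒱.norm_apply_le t s _).trans (hB s hs.1)) (norm_nonneg _)
  · have hne : ∀ᵐ s : ℝ ∂(volume.restrict (Set.Ioo 0 T)), s ≠ t₀ :=
      ae_restrict_of_ae (by simp [ae_iff])
    filter_upwards [hne, ae_restrict_mem measurableSet_Ioo] with s hs hs0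
    rcases lt_or_gt_of_ne hs with hlt | hgt
    · have h1 : Tendsto (fun t => k s • 𝒱.V t s (g s)) (𝓝 t₀) (𝓝 (k s • 𝒱.V t₀ s (g s))) := by
        have hopen : IsOpen {z : ℝ × ℝ | 0 < z.2 ∧ z.2 < z.1} :=
          (isOpen_lt continuous_const continuous_snd).inter
            (isOpen_lt continuous_snd continuous_fst)
        have h2 : ContinuousAt (fun z : ℝ × ℝ => 𝒱.V z.1 z.2) (t₀, s) :=
          𝒱.continuousOn.continuousAt (hopen.mem_nhds ⟨hs0.1, hlt⟩)
        have h3 : ContinuousAt (fun t => 𝒱.V t s) t₀ :=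
          ContinuousAt.comp (f := fun t : ℝ => (t, s)) h2 (Continuous.continuousAt (by fun_prop))
        exact ((h3.clm_apply continuousAt_const).tendsto).const_smul (k s)
      have h4 : F t₀ s = k s • 𝒱.V t₀ s (g s) := Set.indicator_of_mem (by exact hlt) _
      rw [h4]
      refine h1.congr' ?_
      filter_upwards [lt_mem_nhds hlt] with t ht
      exact (Set.indicator_of_mem (s := Set.Iio t) (by exact ht)
        fun s => k s • 𝒱.V t s (g s)).symm
    · have h4 : F t₀ s = 0 := Set.indicator_of_notMem (by simp [hgt.le]) _
      rw [h4]
      refine tendsto_const_nhds.congr' ?_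
      filter_upwards [gt_mem_nhds hgt] with t ht
      exact (Set.indicator_of_notMem (s := Set.Iio t) (by simpa using le_of_lt ht)
        fun s => k s • 𝒱.V t s (g s)).symm

end EvolutionFamily

theorem intervalIntegrable_of_integrableOn {h : ℝ → ℝ}
    (hint : ∀ T : ℝ, 0 < T → IntegrableOn h (Set.Ioc 0 T)) {t : ℝ} (ht : 0 ≤ t) :
    IntervalIntegrable h volume 0 t := by
  rcases ht.eq_or_lt with rfl | ht
  · exact IntervalIntegrable.refl
  · exact (intervalIntegrable_iff_integrableOn_Ioc_of_le ht.le).2 (hint t ht)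

/-! ### The Duhamel equation with an exponential shift. -/

section Shifted

variable {A : Type*} [NormedAddCommGroup A] [NormedSpace ℝ A] [CompleteSpace A]
  (𝒱 : EvolutionFamily A) {h : ℝ → ℝ} (hpos : ∀ t : ℝ, 0 < t → 0 < h t)
  (hint : ∀ T : ℝ, 0 < T → IntegrableOn h (Set.Ioc 0 T))

include hint in
theorem continuousOn_primitive : ContinuousOn (primitive h) (Set.Ioi 0) := by
  intro t ht
  have ht : 0 < t := ht
  have h1 := (primitive_absolutelyContinuous (intervalIntegrable_of_integrableOn hint
    (by linarith : (0 : ℝ) ≤ t + 1))).continuousOn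
  rw [Set.uIcc_of_le (by linarith)] at h1
  exact (h1.continuousAt (Icc_mem_nhds ht (by linarith))).continuousWithinAt

include hint in
theorem intervalIntegrable_exp_mul {t : ℝ} (ht : 0 ≤ t) (l : ℝ) :
    IntervalIntegrable (fun s => Real.exp (l * primitive h s) * h s) volume 0 t :=
  (intervalIntegrable_of_integrableOn hint ht).continuousOn_mul
    (exp_primitive_absolutelyContinuous (intervalIntegrable_of_integrableOn hint ht) l).continuousOn

include hint in
theorem integral_exp_mul {t l : ℝ} (ht : 0 ≤ t) (hl : 0 < l) :
    ∫ s in (0 : ℝ)..t, Real.exp (l * primitive h s) * h s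
      = (Real.exp (l * primitive h t) - 1) / l := by
  have h1 := integral_exp_primitive_mul (intervalIntegrable_of_integrableOn hint ht) l
  rw [← h1, eq_div_iff hl.ne', ← intervalIntegral.integral_mul_const]
  exact intervalIntegral.integral_congr fun s _ => by ring

include hpos hint in
/-- Solvability of the Duhamel equation with the exponential shift `l`. -/
theorem exists_shifted_mild_solution {c : ℝ → A} (hc : ContinuousOn c (Set.Ioi 0)) {M : ℝ}
    (hcM : ∀ t, 0 < t → ‖c t‖ ≤ M) {G : A → A} {l B : ℝ} (hl : 0 < l)
    (hG : ∀ a b, ‖G a - G b‖ ≤ l * ‖a - b‖) (hGB : ∀ a, ‖G a‖ ≤ B) :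
    ∃ w : ℝ → A, ContinuousOn w (Set.Ioi 0) ∧ ∀ t, 0 < t →
      w t = Real.exp (-l * primitive h t) • (c t + ∫ s in (0 : ℝ)..t,
        (Real.exp (l * primitive h s) * h s) • 𝒱.V t s (G (w s))) := by
  have hB : 0 ≤ B := (norm_nonneg _).trans (hGB 0)
  have hGc : Continuous G :=
    (LipschitzWith.of_dist_le_mul (K := ⟨l, hl.le⟩) fun a b => by
      simp only [dist_eq_norm]; exact hG a b).continuous
  have hH := continuousOn_primitive hint
  have hH0 : ∀ t, 0 < t → 0 ≤ primitive h t := fun t ht => primitive_nonneg hpos ht.le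
  set k : ℝ → ℝ := fun s => Real.exp (l * primitive h s) * h s with hk
  have hk0 : ∀ s, 0 < s → 0 ≤ k s := fun s hs => mul_nonneg (Real.exp_pos _).le (hpos s hs).le
  have hki : ∀ t, 0 < t → IntervalIntegrable k volume 0 t := fun t ht =>
    intervalIntegrable_exp_mul hint ht.le l
  -- the extension of a weighted trajectory to the whole line
  set ex : BoundedContinuousFunction (Set.Ioi (0 : ℝ)) A → ℝ → A := fun v s =>
    if hs : 0 < s then Real.exp (2 * l * primitive h s) • v ⟨s, hs⟩ else 0 with hex
  have hexc : ∀ v, ContinuousOn (ex v) (Set.Ioi 0) := by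
    intro v
    rw [continuousOn_iff_continuous_domRestrict]
    have h1 : (Set.Ioi (0 : ℝ)).domRestrict (ex v)
        = fun s : Set.Ioi (0 : ℝ) => Real.exp (2 * l * primitive h s) • v s := by
      funext s
      have hs : 0 < (s : ℝ) := s.2
      simp [hex, hs]
    rw [h1]
    have h2 : Continuous fun s : Set.Ioi (0 : ℝ) => primitive h s :=
      continuousOn_iff_continuous_domRestrict.1 hH
    fun_prop
  set P : (ℝ → A) → ℝ → A := fun w t => Real.exp (-l * primitive h t) • (c t +
    ∫ s in (0 : ℝ)..t, k s • 𝒱.V t s (G (w s))) with hP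
  have hPc : ∀ w, ContinuousOn w (Set.Ioi 0) → ContinuousOn (P w) (Set.Ioi 0) := by
    intro w hw
    have h1 := 𝒱.continuousOn_integral hki (hGc.comp_continuousOn hw) fun s _ => hGB (w s)
    exact ContinuousOn.smul (by fun_prop) (hc.add h1)
  have hPb : ∀ w, ContinuousOn w (Set.Ioi 0) → ∀ t, 0 < t → ‖P w t‖ ≤ M + B / l := by
    intro w hw t ht
    have h1 := 𝒱.norm_integral_le (g := fun s => G (w s)) (b := fun _ => B) ht hk0
      ((hki t ht).mul_const B) fun s _ => hGB (w s)
    rw [intervalIntegral.integral_mul_const, hk, integral_exp_mul hint ht.le hl] at h1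
    have h2 : Real.exp (-l * primitive h t) ≤ 1 := Real.exp_le_one_iff.2 (by
      have := mul_nonneg hl.le (hH0 t ht)
      linarith)
    have h3 : Real.exp (-l * primitive h t) * Real.exp (l * primitive h t) = 1 := by
      rw [← Real.exp_add]; simp
    have hM : 0 ≤ M := (norm_nonneg _).trans (hcM t ht)
    have h4 := Real.exp_pos (-l * primitive h t)
    calc ‖P w t‖ = Real.exp (-l * primitive h t) * ‖c t + ∫ s in (0 : ℝ)..t,
          k s • 𝒱.V t s (G (w s))‖ := by
          rw [hP, norm_smul, Real.norm_eq_abs, Real.abs_exp]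
      _ ≤ Real.exp (-l * primitive h t) * (M + (Real.exp (l * primitive h t) - 1) / l * B) := by
          gcongr
          exact (norm_add_le _ _).trans (add_le_add (hcM t ht) h1)
      _ = Real.exp (-l * primitive h t) * M + (1 - Real.exp (-l * primitive h t)) * (B / l) := by
          linear_combination B / l * h3
      _ ≤ 1 * M + 1 * (B / l) := by gcongr; linarith
      _ = M + B / l := by ring
  -- The map `P` conjugated by the weight: a bounded v stands for w = e^(2lH) v. Time 0 is left out
  -- since `c` need not be continuous there.
  set Q : BoundedContinuousFunction (Set.Ioi (0 : ℝ)) A →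
      BoundedContinuousFunction (Set.Ioi (0 : ℝ)) A := fun v =>
    BoundedContinuousFunction.ofNormedAddCommGroup
      (fun t => Real.exp (-(2 * l * primitive h t)) • P (ex v) t)
      (by
        have h1 : Continuous fun s : Set.Ioi (0 : ℝ) => primitive h s :=
          continuousOn_iff_continuous_domRestrict.1 hH
        have h2 : Continuous fun s : Set.Ioi (0 : ℝ) => P (ex v) s :=
          continuousOn_iff_continuous_domRestrict.1 (hPc _ (hexc v))
        exact Continuous.smul (by fun_prop) h2) (M + B / l)
      (fun t => by
        have ht : 0 < (t : ℝ) := t.2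
        rw [norm_smul, Real.norm_eq_abs, Real.abs_exp]
        have h1 : Real.exp (-(2 * l * primitive h t)) ≤ 1 := Real.exp_le_one_iff.2 (by
          have := mul_nonneg hl.le (hH0 t ht)
          linarith)
        exact (mul_le_of_le_one_left (norm_nonneg _) h1).trans (hPb _ (hexc v) t ht)) with hQ
  -- The integral ∫₀ᵗ l h e^(3lH) equals (e^(3lH(t)) - 1)/3 and the prefactors are e^(-2lH(t))
  -- e^(-lH(t)), whence the constant 1/3, uniform in t even when H is unbounded.
  have hQc : ContractingWith (1 / 3) Q := by
    refine ⟨by rw [← NNReal.coe_lt_coe]; norm_num, LipschitzWith.of_dist_le_mul fun v v' => ?_⟩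
    rw [BoundedContinuousFunction.dist_le (by positivity)]
    intro t
    have ht : 0 < (t : ℝ) := t.2
    set d := dist v v' with hd
    have hd0 : 0 ≤ d := dist_nonneg
    have hexd : ∀ s, 0 < s → ‖G (ex v s) - G (ex v' s)‖ ≤
        l * (Real.exp (2 * l * primitive h s) * d) := by
      intro s hs
      refine (hG _ _).trans ?_
      gcongr
      simp only [hex, dif_pos hs]
      rw [← smul_sub, norm_smul, Real.norm_eq_abs, Real.abs_exp]
      gcongr
      rw [← dist_eq_norm]
      exact BoundedContinuousFunction.dist_coe_le_dist _
    have hi : IntervalIntegrable (fun s => k s * (l * (Real.exp (2 * l * primitive h s) * d)))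
        volume 0 t := by
      refine ((intervalIntegrable_exp_mul hint ht.le (3 * l)).const_mul (l * d)).congr ?_
      intro s _
      simp only [hk]
      rw [show 3 * l * primitive h s = l * primitive h s + 2 * l * primitive h s by ring,
        Real.exp_add]
      ring
    have h1 := 𝒱.norm_integral_le (g := fun s => G (ex v s) - G (ex v' s)) ht hk0 hi hexd
    have h2 : ∫ s in (0 : ℝ)..t, k s * (l * (Real.exp (2 * l * primitive h s) * d))
        = d * ((Real.exp (3 * l * primitive h t) - 1) / 3) := by
      have h3 : ∀ s, k s * (l * (Real.exp (2 * l * primitive h s) * d))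
          = (l * d) * (Real.exp (3 * l * primitive h s) * h s) := by
        intro s
        simp only [hk]
        rw [show 3 * l * primitive h s = l * primitive h s + 2 * l * primitive h s by ring,
          Real.exp_add]
        ring
      simp only [h3]
      rw [intervalIntegral.integral_const_mul, integral_exp_mul hint ht.le (by positivity)]
      field_simp
    rw [h2] at h1
    have h4 : (∫ s in (0 : ℝ)..t, k s • 𝒱.V t s (G (ex v s) - G (ex v' s)))
        = (∫ s in (0 : ℝ)..t, k s • 𝒱.V t s (G (ex v s)))
          - ∫ s in (0 : ℝ)..t, k s • 𝒱.V t s (G (ex v' s)) := by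
      rw [← intervalIntegral.integral_sub
        (𝒱.intervalIntegrable (g := fun s => G (ex v s)) ht (hki t ht)
          (hGc.comp_continuousOn (hexc v)) fun s _ => hGB _)
        (𝒱.intervalIntegrable (g := fun s => G (ex v' s)) ht (hki t ht)
          (hGc.comp_continuousOn (hexc v')) fun s _ => hGB _)]
      simp only [map_sub, smul_sub]
    rw [h4] at h1
    have h5 : Real.exp (-(2 * l * primitive h t)) * Real.exp (-l * primitive h t) *
        Real.exp (3 * l * primitive h t) = 1 := by
      rw [← Real.exp_add, ← Real.exp_add]
      ring_nf
      simp
    simp only [hQ, BoundedContinuousFunction.coe_ofNormedAddCommGroup, hP]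
    rw [dist_eq_norm, ← smul_sub, ← smul_sub, add_sub_add_left_eq_sub, norm_smul, norm_smul,
      Real.norm_eq_abs, Real.norm_eq_abs, Real.abs_exp, Real.abs_exp]
    have h6 := Real.exp_pos (-(2 * l * primitive h t))
    have h7 := Real.exp_pos (-l * primitive h t)
    refine (mul_le_mul_of_nonneg_left (mul_le_mul_of_nonneg_left h1 h7.le) h6.le).trans ?_
    have h8 : Real.exp (-(2 * l * primitive h t)) * (Real.exp (-l * primitive h t) *
        (d * ((Real.exp (3 * l * primitive h t) - 1) / 3)))
        = d / 3 * (1 - Real.exp (-(2 * l * primitive h t)) * Real.exp (-l * primitive h t)) := by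
      linear_combination d / 3 * h5
    rw [h8]
    have h9 : 0 ≤ Real.exp (-(2 * l * primitive h t)) * Real.exp (-l * primitive h t) := by
      positivity
    push_cast
    nlinarith
  set v := ContractingWith.fixedPoint Q hQc with hv
  have hfix : Q v = v := hQc.fixedPoint_isFixedPt
  refine ⟨ex v, hexc v, fun t ht => ?_⟩
  have h1 := congrArg (fun v : BoundedContinuousFunction (Set.Ioi (0 : ℝ)) A => v ⟨t, ht⟩) hfix
  simp only [hQ, BoundedContinuousFunction.coe_ofNormedAddCommGroup] at h1
  change ex v t = P (ex v) t
  have h2 : ex v t = Real.exp (2 * l * primitive h t) • v ⟨t, ht⟩ := by simp [hex, ht]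
  rw [h2, ← h1, smul_smul, ← Real.exp_add]
  simp

include hint in
/-- A solution of the shifted Duhamel equation solves the original one. -/
theorem mild_of_shifted_mild {c : ℝ → A} (hcV : ∀ s t, 0 < s → s < t → 𝒱.V t s (c s) = c t)
    {g w : ℝ → A} (hg : ContinuousOn g (Set.Ioi 0)) {B M : ℝ} (hgB : ∀ t, 0 < t → ‖g t‖ ≤ B)
    (hw : ContinuousOn w (Set.Ioi 0)) (hwM : ∀ t, 0 < t → ‖w t‖ ≤ M) {l : ℝ}
    (hshift : ∀ t, 0 < t → w t = Real.exp (-l * primitive h t) • (c t + ∫ s in (0 : ℝ)..t,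
        (Real.exp (l * primitive h s) * h s) • 𝒱.V t s (g s))) {t : ℝ} (ht : 0 < t) :
    w t = c t + ∫ s in (0 : ℝ)..t, h s • 𝒱.V t s (g s - l • w s) := by
  set k : ℝ → ℝ := fun s => Real.exp (l * primitive h s) * h s with hk
  have hh := intervalIntegrable_of_integrableOn hint ht.le
  have hki : ∀ t, 0 < t → IntervalIntegrable k volume 0 t := fun t ht =>
    intervalIntegrable_exp_mul hint ht.le l
  have hIg := 𝒱.intervalIntegrable ht hh hg hgB
  have hIk := 𝒱.intervalIntegrable ht (hki t ht) hg hgB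
  have hIw := 𝒱.intervalIntegrable ht hh hw hwM
  -- the propagated solution at intermediate times
  have hVw : ∀ s, 0 < s → s < t → 𝒱.V t s (w s) = Real.exp (-l * primitive h s) •
      (c t + ∫ r in (0 : ℝ)..s, k r • 𝒱.V t r (g r)) := by
    intro s hs hst
    rw [hshift s hs, map_smul, map_add, hcV s t hs hst,
      ← ContinuousLinearMap.intervalIntegral_comp_comm _
        (𝒱.intervalIntegrable hs (hki s hs) hg hgB)]
    congr 2
    refine intervalIntegral.integral_congr_ae ?_
    have hne : ∀ᵐ r : ℝ, r ≠ s := by simp [ae_iff]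
    filter_upwards [hne] with r hrs hr
    rw [Set.uIoc_of_le hs.le] at hr
    rw [map_smul, 𝒱.comp r s t hr.1 (lt_of_le_of_ne hr.2 hrs) hst]
  -- Testing with functionals makes the claim scalar. For fixed t, y(s) = ℓ(V t s (w s)) =
  -- e^(-lH(s)) (ℓ(c t) + ∫₀ˢ k ζ) for s < t, and this formula solves y' = h (ζ - l y) almost
  -- everywhere; integrating it by parts up to s = t gives the unshifted equation.
  refine (SeparatingDual.eq_iff_forall_dual_eq (R := ℝ)).2 fun ℓ => ?_
  set ζ : ℝ → ℝ := fun r => ℓ (𝒱.V t r (g r)) with hζ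
  have hIkζ : IntervalIntegrable (fun r => k r * ζ r) volume 0 t := by
    refine (show IntervalIntegrable (fun r => ℓ (k r • 𝒱.V t r (g r))) volume 0 t from
      ⟨ℓ.integrable_comp hIk.1, ℓ.integrable_comp hIk.2⟩).congr fun r _ => ?_
    simp only [map_smul, smul_eq_mul, hζ]
  have hIhζ : IntervalIntegrable (fun r => h r * ζ r) volume 0 t := by
    refine (show IntervalIntegrable (fun r => ℓ (h r • 𝒱.V t r (g r))) volume 0 t from
      ⟨ℓ.integrable_comp hIg.1, ℓ.integrable_comp hIg.2⟩).congr fun r _ => ?_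
    simp only [map_smul, smul_eq_mul, hζ]
  have hℓk : ∀ s, 0 < s → s ≤ t → ℓ (∫ r in (0 : ℝ)..s, k r • 𝒱.V t r (g r))
      = ∫ r in (0 : ℝ)..s, k r * ζ r := by
    intro s hs hst
    have hsub : Set.uIcc 0 s ⊆ Set.uIcc 0 t := by
      rw [Set.uIcc_of_le hs.le, Set.uIcc_of_le ht.le]
      exact Set.Icc_subset_Icc_right hst
    rw [← ContinuousLinearMap.intervalIntegral_comp_comm _ (hIk.mono_set hsub)]
    simp only [map_smul, smul_eq_mul, hζ]
  have hIdiff : IntervalIntegrable (fun s => h s • 𝒱.V t s (g s - l • w s)) volume 0 t := by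
    have hIlw : IntervalIntegrable (fun s => l • h s • 𝒱.V t s (w s)) volume 0 t :=
      ⟨hIw.1.smul l, hIw.2.smul l⟩
    refine (hIg.sub hIlw).congr fun s _ => ?_
    simp only [map_sub, map_smul, smul_sub]
    rw [smul_comm]
  have hIe : IntervalIntegrable (fun s => Real.exp (-l * primitive h s) * (-l * h s))
      volume 0 t :=
    (hh.const_mul (-l)).continuousOn_mul (exp_primitive_absolutelyContinuous hh (-l)).continuousOn
  have hIeZ : IntervalIntegrable (fun s => Real.exp (-l * primitive h s) * (-l * h s) *
      ∫ r in (0 : ℝ)..s, k r * ζ r) volume 0 t :=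
    hIe.mul_continuousOn (hIkζ.absolutelyContinuousOnInterval_intervalIntegral
      (c := 0) (by simp)).continuousOn
  have hexp : ∀ r, Real.exp (-l * primitive h r) * (k r * ζ r) = h r * ζ r := by
    intro r
    have : Real.exp (-l * primitive h r) * Real.exp (l * primitive h r) = 1 := by
      rw [← Real.exp_add]; simp
    simp only [hk]
    linear_combination h r * ζ r * this
  have h1 : ∫ s in (0 : ℝ)..t, ℓ (h s • 𝒱.V t s (g s - l • w s))
      = ∫ s in (0 : ℝ)..t, (h s * ζ s + Real.exp (-l * primitive h s) * (-l * h s) * ℓ (c t)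
        + Real.exp (-l * primitive h s) * (-l * h s) * ∫ r in (0 : ℝ)..s, k r * ζ r) := by
    refine intervalIntegral.integral_congr_ae ?_
    have hne : ∀ᵐ s : ℝ, s ≠ t := by simp [ae_iff]
    filter_upwards [hne] with s hst hs
    rw [Set.uIoc_of_le ht.le] at hs
    rw [map_smul, map_sub, map_sub, map_smul, hVw s hs.1 (lt_of_le_of_ne hs.2 hst), map_smul,
      map_smul, map_add, hℓk s hs.1 hs.2]
    simp only [smul_eq_mul, hζ]
    ring
  have h2 : ∫ s in (0 : ℝ)..t, (Real.exp (-l * primitive h t) - Real.exp (-l * primitive h s)) *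
      (k s * ζ s) = Real.exp (-l * primitive h t) * (∫ s in (0 : ℝ)..t, k s * ζ s)
        - ∫ s in (0 : ℝ)..t, h s * ζ s := by
    simp only [sub_mul, hexp]
    rw [intervalIntegral.integral_sub (hIkζ.const_mul _) hIhζ, intervalIntegral.integral_const_mul]
  rw [hshift t ht, map_smul, map_add, map_add, hℓk t ht le_rfl,
    ← ContinuousLinearMap.intervalIntegral_comp_comm _ hIdiff, h1,
    intervalIntegral.integral_add (hIhζ.add (hIe.mul_const _)) hIeZ,
    intervalIntegral.integral_add hIhζ (hIe.mul_const _), intervalIntegral.integral_mul_const,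
    integral_exp_primitive_mul hh, integral_exp_primitive_mul_integral hh _ hIkζ, h2, smul_eq_mul]
  ring

end Shifted

end MixedHeat

namespace MixedHeat

/-! ### The power nonlinearity -/

/-- The nonlinearity `|x|^{p-1} x`. -/
noncomputable def signedPow (p x : ℝ) : ℝ := |x| ^ (p - 1) * x

section SignedPow

variable {p M : ℝ} (hp : 1 < p)

theorem signedPow_neg (x : ℝ) : signedPow p (-x) = -signedPow p x := by
  simp [signedPow]

include hp in
theorem signedPow_of_nonneg {x : ℝ} (hx : 0 ≤ x) : signedPow p x = x ^ p := by
  rw [signedPow, abs_of_nonneg hx, ← Real.rpow_add_one' hx (by linarith), sub_add_cancel]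

include hp in
theorem continuous_signedPow : Continuous (signedPow p) := by
  unfold signedPow
  exact (continuous_abs.rpow_const fun _ => Or.inr (by linarith)).mul continuous_id

include hp in
theorem abs_signedPow_sub_le_of_nonneg {x y : ℝ} (hx : 0 ≤ x) (hxM : x ≤ M) (hy : 0 ≤ y)
    (hyM : y ≤ M) : |signedPow p x - signedPow p y| ≤ p * M ^ (p - 1) * |x - y| := by
  rw [signedPow_of_nonneg hp hx, signedPow_of_nonneg hp hy]
  refine (convex_Icc 0 M).norm_image_sub_le_of_norm_hasDerivWithin_le (f := fun z : ℝ => z ^ p)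
    (f' := fun z : ℝ => p * z ^ (p - 1))
    (fun z _ => (Real.hasDerivAt_rpow_const (Or.inr hp.le)).hasDerivWithinAt) (fun z hz => ?_)
    ⟨hy, hyM⟩ ⟨hx, hxM⟩
  rw [Real.norm_eq_abs, abs_of_nonneg (mul_nonneg (by linarith) (Real.rpow_nonneg hz.1 _))]
  have := hz.1
  have := hz.2
  gcongr

include hp in
-- For opposite signs both distances are sums: each power is at most M^(p-1) times its argument in
-- absolute value, and p ≥ 1 absorbs the rest.
theorem abs_signedPow_sub_le_of_nonneg_of_nonpos {x y : ℝ} (hx : 0 ≤ x) (hxM : x ≤ M) (hy : y ≤ 0)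
    (hyM : -M ≤ y) : |signedPow p x - signedPow p y| ≤ p * M ^ (p - 1) * |x - y| := by
  have hM : 0 ≤ M := hx.trans hxM
  have h1 : signedPow p x ≤ M ^ (p - 1) * x := by
    rw [signedPow, abs_of_nonneg hx]
    gcongr
  have h2 : signedPow p (-y) ≤ M ^ (p - 1) * (-y) := by
    rw [signedPow, abs_of_nonneg (by linarith : 0 ≤ -y)]
    have : 0 ≤ -y := by linarith
    gcongr
    · linarith
  have h3 : 0 ≤ signedPow p x := by
    rw [signedPow_of_nonneg hp hx]
    positivity
  have h4 : 0 ≤ signedPow p (-y) := by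
    rw [signedPow_of_nonneg hp (by linarith)]
    exact Real.rpow_nonneg (by linarith) _
  rw [signedPow_neg] at h2 h4
  have h5 : 0 ≤ M ^ (p - 1) := Real.rpow_nonneg hM _
  rw [abs_of_nonneg (by linarith), abs_of_nonneg (by linarith)]
  have h6 : 0 ≤ M ^ (p - 1) * (x - y) := mul_nonneg h5 (by linarith)
  nlinarith

include hp in
theorem abs_signedPow_sub_le {x y : ℝ} (hx : |x| ≤ M) (hy : |y| ≤ M) :
    |signedPow p x - signedPow p y| ≤ p * M ^ (p - 1) * |x - y| := by
  rw [abs_le] at hx hy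
  rcases le_total 0 x with h | h <;> rcases le_total 0 y with h' | h'
  · exact abs_signedPow_sub_le_of_nonneg hp h hx.2 h' hy.2
  · exact abs_signedPow_sub_le_of_nonneg_of_nonpos hp h hx.2 h' hy.1
  · rw [abs_sub_comm, abs_sub_comm x]
    exact abs_signedPow_sub_le_of_nonneg_of_nonpos hp h' hy.2 h hx.1
  · have h1 := abs_signedPow_sub_le_of_nonneg (M := M) hp (neg_nonneg.2 h) (by linarith)
      (neg_nonneg.2 h') (by linarith)
    rw [signedPow_neg, signedPow_neg, neg_sub_neg, neg_sub_neg, abs_sub_comm,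
      abs_sub_comm y] at h1
    exact h1

theorem signedPow_zero : signedPow p 0 = 0 := by simp [signedPow]

include hp in
theorem abs_signedPow_le {x : ℝ} (hx : |x| ≤ M) :
    |signedPow p x| ≤ p * M ^ (p - 1) * M := by
  have hM : 0 ≤ M := (abs_nonneg x).trans hx
  have h := abs_signedPow_sub_le hp hx (y := 0) (by simpa using hM)
  rw [signedPow_zero, sub_zero, sub_zero] at h
  have : 0 ≤ p * M ^ (p - 1) := mul_nonneg (by linarith) (Real.rpow_nonneg hM _)
  exact h.trans (by gcongr)

/-- The shifted and truncated nonlinearity `l x - |x|^{p-1} x` on `[0, M]`. -/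
noncomputable def shiftedPow (p l M x : ℝ) : ℝ :=
  l * max 0 (min x M) - signedPow p (max 0 (min x M))

variable {l : ℝ} (hM : 0 ≤ M) (hl : p * M ^ (p - 1) ≤ l)

include hp in
theorem continuous_shiftedPow : Continuous (shiftedPow p l M) := by
  have := continuous_signedPow hp
  unfold shiftedPow
  fun_prop

theorem shiftedPow_of_mem {x : ℝ} (hx : 0 ≤ x) (hxM : x ≤ M) :
    shiftedPow p l M x = l * x - signedPow p x := by
  rw [shiftedPow, min_eq_left hxM, max_eq_right hx]

include hp hl in
-- The power is nondecreasing with Lipschitz constant at most l on [0, M], so subtracting it from l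
-- x leaves increments between 0 and l (a - b). Both the range and the Lipschitz constant of
-- `shiftedPow` follow.
theorem mul_sub_signedPow_mem {a b : ℝ} (hb : 0 ≤ b) (hba : b ≤ a) (haM : a ≤ M) :
    0 ≤ (l * a - signedPow p a) - (l * b - signedPow p b) ∧
      (l * a - signedPow p a) - (l * b - signedPow p b) ≤ l * (a - b) := by
  have h1 := abs_signedPow_sub_le_of_nonneg hp (hb.trans hba) haM hb (hba.trans haM)
  have h2 : signedPow p b ≤ signedPow p a := by
    rw [signedPow_of_nonneg hp hb, signedPow_of_nonneg hp (hb.trans hba)]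
    gcongr
  rw [abs_of_nonneg (by linarith), abs_of_nonneg (by linarith)] at h1
  have h3 : p * M ^ (p - 1) * (a - b) ≤ l * (a - b) := by gcongr
  constructor <;> linarith

include hp hM hl in
theorem shiftedPow_mem (x : ℝ) : 0 ≤ shiftedPow p l M x ∧ shiftedPow p l M x ≤ l * M := by
  have h0 : 0 ≤ max 0 (min x M) := le_max_left _ _
  have h1 : max 0 (min x M) ≤ M := max_le hM (min_le_right _ _)
  have h2 := mul_sub_signedPow_mem hp hl le_rfl h0 h1
  have h3 : 0 ≤ l := le_trans (mul_nonneg (by linarith) (Real.rpow_nonneg hM _)) hl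
  simp only [signedPow_zero, mul_zero, sub_zero] at h2
  exact ⟨h2.1, h2.2.trans (by gcongr)⟩

include hp hM hl in
theorem abs_shiftedPow_sub_le (x y : ℝ) :
    |shiftedPow p l M x - shiftedPow p l M y| ≤ l * |x - y| := by
  have h3 : 0 ≤ l := le_trans (mul_nonneg (by linarith) (Real.rpow_nonneg hM _)) hl
  wlog hxy : y ≤ x generalizing x y
  · rw [abs_sub_comm, abs_sub_comm x]
    exact this y x (le_of_not_ge hxy)
  have h0 : 0 ≤ max 0 (min y M) := le_max_left _ _
  have h1 : max 0 (min x M) ≤ M := max_le hM (min_le_right _ _)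
  have h4 : max 0 (min y M) ≤ max 0 (min x M) := by gcongr
  have h5 := mul_sub_signedPow_mem hp hl h0 h4 h1
  have h6 : max 0 (min x M) - max 0 (min y M) ≤ x - y := by
    have e1 := abs_max_sub_max_le_abs (min x M) (min y M) 0
    have e2 := abs_min_sub_min_le_max x M y M
    rw [sub_self, abs_zero, max_eq_left (abs_nonneg _)] at e2
    rw [max_comm 0, max_comm 0]
    rw [abs_of_nonneg (by linarith : 0 ≤ x - y)] at e2
    exact (le_abs_self _).trans (e1.trans e2)
  rw [shiftedPow, shiftedPow, abs_of_nonneg h5.1, abs_of_nonneg (by linarith : 0 ≤ x - y)]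
  exact h5.2.trans (by gcongr)

end SignedPow

/-! ### The time change -/

section TimeChange

variable {β : ℝ} (hβ : 0 ≤ β)

include hβ in
theorem continuous_timeChange : Continuous (timeChange β) := by
  unfold timeChange
  exact (continuous_id.rpow_const fun _ => Or.inr (by linarith)).div_const _

include hβ in
theorem timeChange_zero : timeChange β 0 = 0 := by
  rw [timeChange, Real.zero_rpow (by linarith), zero_div]

include hβ in
theorem timeChange_lt {s t : ℝ} (hs : 0 ≤ s) (hst : s < t) : timeChange β s < timeChange β t := by
  unfold timeChange
  gcongr

include hβ in
theorem timeChange_pos {t : ℝ} (ht : 0 < t) : 0 < timeChange β t := by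
  rw [← timeChange_zero hβ]
  exact timeChange_lt hβ le_rfl ht

end TimeChange

variable {N : ℕ} {α β p : ℝ} {h : ℝ → ℝ}

local notation "E" => EuclideanSpace ℝ (Fin N)

theorem duhamelIntegrand_eq (hN : 1 ≤ N) (hα0 : 0 < α) (hβ : 0 ≤ β) (u : ℝ → LInf N) {s t : ℝ}
    (hs : 0 ≤ s) (hst : s < t) (x : E) :
    duhamelIntegrand N α β p h u t s x
      = h s * heatConv α (timeChange β t - timeChange β s) (fun y => signedPow p (u s y)) x := by
  rw [duhamelIntegrand,
    semigroup_eq_heatConv hN hα0 (sub_pos.2 (timeChange_lt hβ hs hst))]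
  rfl

/-! ### Uniqueness -/

/-- Both solutions lie in a ball of radius C, where the odd power is Lipschitz with constant p
C^(p-1), and convolution with the kernel is a contraction; Gronwall's lemma finishes. No sign is
imposed on the competitors, so the Lipschitz bound must cover both signs. -/
theorem IsMildSolution.unique (hN : 1 ≤ N) (hα0 : 0 < α) (hα2 : α < 2) (hβ : 0 ≤ β) (hp : 1 < p)
    (hpos : ∀ t : ℝ, 0 < t → 0 < h t) (hint : ∀ T : ℝ, 0 < T → IntegrableOn h (Set.Ioc 0 T))
    {u₀ : LInf N} {T : ℝ} (hT : 0 < T) {u v : ℝ → LInf N}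
    (hu : IsMildSolution N α β p h u₀ T u) (hv : IsMildSolution N α β p h u₀ T v) :
    ∀ t ∈ Set.Icc 0 T, v t = u t := by
  obtain ⟨C₁, hC₁⟩ := hu.bounded
  obtain ⟨C₂, hC₂⟩ := hv.bounded
  set C := max C₁ C₂ with hC
  have hu' : ∀ t ∈ Set.Icc 0 T, ‖u t‖ ≤ C := fun t ht => (hC₁ t ht).trans (le_max_left _ _)
  have hv' : ∀ t ∈ Set.Icc 0 T, ‖v t‖ ≤ C := fun t ht => (hC₂ t ht).trans (le_max_right _ _)
  have hC0 : 0 ≤ C := (norm_nonneg _).trans (hu' 0 ⟨le_rfl, hT.le⟩)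
  set L := p * C ^ (p - 1) with hL
  have hL0 : 0 ≤ L := mul_nonneg (by linarith) (Real.rpow_nonneg hC0 _)
  have hcont := continuous_signedPow hp
  have hφ : ∀ t ∈ Set.Icc 0 T, ‖v t - u t‖ ≤ ∫ s in (0 : ℝ)..t, h s * (L * ‖v s - u s‖) := by
    intro t ht
    have hbound : IntervalIntegrable (fun s => h s * (L * ‖v s - u s‖)) volume 0 t := by
      rw [intervalIntegrable_iff_integrableOn_Ioc_of_le ht.1]
      have hh := (intervalIntegrable_iff_integrableOn_Ioc_of_le ht.1).1
        (intervalIntegrable_of_integrableOn hint ht.1)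
      refine Integrable.mul_bdd (c := L * (C + C)) hh ?_ ?_
      · have hm := (hv.aestronglyMeasurable.sub hu.aestronglyMeasurable).mono_measure
          (Measure.restrict_mono (Set.Ioc_subset_Icc_self.trans (Set.Icc_subset_Icc_right ht.2))
            le_rfl)
        exact hm.norm.const_mul L
      · refine (ae_restrict_iff' measurableSet_Ioc).2 (.of_forall fun s hs => ?_)
        have hsT : s ∈ Set.Icc 0 T := ⟨hs.1.le, hs.2.trans ht.2⟩
        rw [Real.norm_eq_abs, abs_of_nonneg (by positivity)]
        gcongr
        exact (norm_sub_le _ _).trans (add_le_add (hv' s hsT) (hu' s hsT))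
    refine norm_le_of_ae_abs_le (intervalIntegral.integral_nonneg_of_ae_restrict ht.1 ?_) ?_
    · refine ae_restrict_of_ae_restrict_of_subset (s := Set.Icc 0 t) subset_rfl ?_
      have hne : ∀ᵐ s : ℝ, s ≠ 0 := by simp [ae_iff]
      filter_upwards [ae_restrict_of_ae hne, ae_restrict_mem measurableSet_Icc] with s hs0 hs
      exact mul_nonneg (hpos s (lt_of_le_of_ne hs.1 hs0.symm)).le (by positivity)
    · filter_upwards [hu.duhamel t ht, hv.duhamel t ht, hu.integrable t ht, hv.integrable t ht,
        Lp.coeFn_sub (v t) (u t)] with x hux hvx huI hvI hsub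
      rw [hsub, Pi.sub_apply, hux, hvx, sub_sub_sub_cancel_left,
        ← intervalIntegral.integral_sub huI hvI, ← Real.norm_eq_abs]
      refine intervalIntegral.norm_integral_le_of_norm_le ht.1 ?_ hbound
      have hne : ∀ᵐ s : ℝ, s ≠ t := by simp [ae_iff]
      filter_upwards [hne] with s hst hs
      have hslt : s < t := lt_of_le_of_ne hs.2 hst
      have hsT : s ∈ Set.Icc 0 T := ⟨hs.1.le, hs.2.trans ht.2⟩
      have hr := sub_pos.2 (timeChange_lt hβ hs.1.le hslt)
      have hub : ∀ᵐ y : E, |u s y| ≤ C :=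
        (ae_abs_le_norm (u s)).mono fun y hy => hy.trans (hu' s hsT)
      have hvb : ∀ᵐ y : E, |v s y| ≤ C :=
        (ae_abs_le_norm (v s)).mono fun y hy => hy.trans (hv' s hsT)
      have hum : AEStronglyMeasurable (fun y => signedPow p (u s y)) (volume : Measure E) :=
        hcont.comp_aestronglyMeasurable (Lp.aestronglyMeasurable (u s))
      have hvm : AEStronglyMeasurable (fun y => signedPow p (v s y)) (volume : Measure E) :=
        hcont.comp_aestronglyMeasurable (Lp.aestronglyMeasurable (v s))
      rw [duhamelIntegrand_eq hN hα0 hβ u hs.1.le hslt, duhamelIntegrand_eq hN hα0 hβ v hs.1.le hslt,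
        ← mul_sub, ← heatConv_sub hα0 hα2 hr hum (hub.mono fun y hy => abs_signedPow_le hp hy) hvm
        (hvb.mono fun y hy => abs_signedPow_le hp hy), norm_mul, Real.norm_eq_abs, Real.norm_eq_abs,
        abs_of_pos (hpos s hs.1)]
      refine mul_le_mul_of_nonneg_left (abs_heatConv_le hα0 hα2 hr ?_ x) (hpos s hs.1).le
      filter_upwards [hub, hvb, Lp.coeFn_sub (v s) (u s), ae_abs_le_norm (v s - u s)]
        with y h1 h2 h3 h4
      rw [h3, Pi.sub_apply] at h4
      refine (abs_signedPow_sub_le hp h1 h2).trans ?_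
      rw [abs_sub_comm]
      gcongr
  have hzero := eq_zero_of_le_integral hpos (intervalIntegrable_of_integrableOn hint hT.le) hL0
    (φ := fun t => ‖v t - u t‖) (C := C + C) (fun t _ => norm_nonneg _)
    (fun t ht => (norm_sub_le _ _).trans (add_le_add (hv' t ht) (hu' t ht))) hφ
  intro t ht
  exact sub_eq_zero.1 (norm_eq_zero.1 (hzero t ht))

/-! ### Existence -/

/-- The evolution family of `∂ₜ + t^β 𝓛` on bounded continuous functions. -/
noncomputable def heatEvolution (N : ℕ) (hα0 : 0 < α) (hα2 : α < 2) (hβ : 0 ≤ β) :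
    EvolutionFamily (Cb N) where
  V t s := (heatOp hα0 hα2 (timeChange β t - timeChange β s)).comp bcfToLInf
  norm_le t s := by
    refine (ContinuousLinearMap.opNorm_comp_le _ _).trans ?_
    exact mul_le_one₀ (norm_heatOp_le hα0 hα2 _) (norm_nonneg _) norm_bcfToLInf_le
  continuousOn := by
    have hτ := continuous_timeChange hβ
    have h1 : ContinuousOn (fun z : ℝ × ℝ =>
        heatOp (N := N) hα0 hα2 (timeChange β z.1 - timeChange β z.2))
        {z | 0 < z.2 ∧ z.2 < z.1} :=
      (continuousOn_heatOp hα0 hα2).comp (by fun_prop)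
        fun z hz => sub_pos.2 (timeChange_lt hβ hz.1.le hz.2)
    exact h1.clm_comp continuousOn_const
  comp r s t hr hrs hst a := by
    have h1 := sub_pos.2 (timeChange_lt hβ hr.le hrs)
    have h2 := sub_pos.2 (timeChange_lt hβ (hr.trans hrs).le hst)
    simp only [ContinuousLinearMap.comp_apply]
    rw [heatOp_bcfToLInf_heatOp hα0 hα2 h2 h1, sub_add_sub_cancel]

theorem heatEvolution_apply (hα0 : 0 < α) (hα2 : α < 2) (hβ : 0 ≤ β) {s t : ℝ} (hs : 0 ≤ s)
    (hst : s < t) (a : Cb N) (x : E) :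
    (heatEvolution N hα0 hα2 hβ).V t s a x
      = heatConv α (timeChange β t - timeChange β s) a x := by
  simp only [heatEvolution, ContinuousLinearMap.comp_apply]
  rw [heatOp_apply _ _ (sub_pos.2 (timeChange_lt hβ hs hst)), heatConv_congr (coeFn_bcfToLInf a)]

/-- The solution for positive times, with values in bounded continuous functions. -/
theorem exists_continuous_solution (hα0 : 0 < α) (hα2 : α < 2) (hβ : 0 ≤ β) (hp : 1 < p)
    (hpos : ∀ t : ℝ, 0 < t → 0 < h t) (hint : ∀ T : ℝ, 0 < T → IntegrableOn h (Set.Ioc 0 T))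
    (u₀ : LInf N) (hu₀ : 0 ≤ u₀) :
    ∃ w f : ℝ → Cb N, ContinuousOn w (Set.Ioi 0) ∧ ContinuousOn f (Set.Ioi 0) ∧
      (∀ t, 0 < t → ∀ x, f t x = signedPow p (w t x)) ∧
      (∀ t, 0 < t → ∀ x, 0 ≤ w t x ∧ w t x ≤ ‖u₀‖) ∧
      ∀ t, 0 < t → w t = heatOp hα0 hα2 (timeChange β t) u₀
        - ∫ s in (0 : ℝ)..t, h s • (heatEvolution N hα0 hα2 hβ).V t s (f s) := by
  set M := ‖u₀‖ with hMdef
  have hM : 0 ≤ M := norm_nonneg _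
  -- The extra 1 keeps l positive when u₀ = 0.
  set l := p * M ^ (p - 1) + 1 with hldef
  have hpM : 0 ≤ p * M ^ (p - 1) := mul_nonneg (by linarith) (Real.rpow_nonneg hM _)
  have hl : p * M ^ (p - 1) ≤ l := by rw [hldef]; linarith
  have hl0 : 0 < l := by rw [hldef]; linarith
  set 𝒱 := heatEvolution N hα0 hα2 hβ with h𝒱
  set c : ℝ → Cb N := fun t => heatOp hα0 hα2 (timeChange β t) u₀ with hcdef
  have hu₀' : ∀ᵐ x : E, 0 ≤ u₀ x := (Lp.coeFn_nonneg u₀).2 hu₀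
  have hcx : ∀ t, 0 < t → ∀ x, 0 ≤ c t x ∧ c t x ≤ M := by
    intro t ht x
    have hτ := timeChange_pos hβ ht
    simp only [hcdef]
    rw [heatOp_apply _ _ hτ]
    refine ⟨integral_nonneg_of_ae ?_, (le_abs_self _).trans
      (abs_heatConv_le hα0 hα2 hτ (ae_abs_le_norm u₀) x)⟩
    filter_upwards [hu₀'] with y hy
    exact mul_nonneg (heatKernel_nonneg hα0 hα2 hτ _) hy
  have hcM : ∀ t, 0 < t → ‖c t‖ ≤ M := fun t ht => Cb.norm_le hM fun x => by
    rw [abs_of_nonneg (hcx t ht x).1]; exact (hcx t ht x).2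
  have hc : ContinuousOn c (Set.Ioi 0) := by
    have h1 : ContinuousOn (fun t => heatOp (N := N) hα0 hα2 (timeChange β t)) (Set.Ioi 0) :=
      (continuousOn_heatOp hα0 hα2).comp (continuous_timeChange hβ).continuousOn
        fun t ht => timeChange_pos hβ ht
    exact h1.clm_apply continuousOn_const
  have hcV : ∀ s t, 0 < s → s < t → 𝒱.V t s (c s) = c t := by
    intro s t hs hst
    simp only [h𝒱, heatEvolution, hcdef, ContinuousLinearMap.comp_apply]
    rw [heatOp_bcfToLInf_heatOp hα0 hα2 (sub_pos.2 (timeChange_lt hβ hs.le hst))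
      (timeChange_pos hβ hs), sub_add_cancel]
  have hγc := continuous_shiftedPow (l := l) (M := M) hp
  have hγ := shiftedPow_mem hp hM hl
  set G : Cb N → Cb N := fun a => Cb.mk (fun x => shiftedPow p l M (a x))
    (hγc.comp a.continuous_coe) (l * M) (fun x => by rw [abs_of_nonneg (hγ _).1]; exact (hγ _).2)
    with hG
  have hGx : ∀ a x, G a x = shiftedPow p l M (a x) := fun a x => rfl
  have hGB : ∀ a, ‖G a‖ ≤ l * M := fun a => Cb.norm_le (by positivity) fun x => by
    rw [hGx, abs_of_nonneg (hγ _).1]; exact (hγ _).2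
  have hGL : ∀ a b, ‖G a - G b‖ ≤ l * ‖a - b‖ := fun a b => Cb.norm_le (by positivity) fun x => by
    rw [Cb.sub_apply, hGx, hGx]
    refine (abs_shiftedPow_sub_le hp hM hl _ _).trans ?_
    rw [← Cb.sub_apply]
    gcongr
    exact Cb.abs_coe_le_norm _ x
  obtain ⟨w, hw, hwt⟩ := exists_shifted_mild_solution 𝒱 hpos hint hc hcM hl0 hGL hGB
  have hGc : Continuous G :=
    (LipschitzWith.of_dist_le_mul (K := ⟨l, hl0.le⟩) fun a b => by
      simp only [dist_eq_norm]; exact hGL a b).continuous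
  have hGw : ContinuousOn (fun s => G (w s)) (Set.Ioi 0) := hGc.comp_continuousOn hw
  -- The truncated source lies in [0, l M] whatever w is. Positivity of the kernel gives the lower
  -- bound, and M e^(-lH) + (1 - e^(-lH)) M = M the upper one.
  have hwx : ∀ t, 0 < t → ∀ x, 0 ≤ w t x ∧ w t x ≤ M := by
    intro t ht x
    have hki := intervalIntegrable_exp_mul hint ht.le l
    have hI := 𝒱.intervalIntegrable ht hki hGw fun s _ => hGB (w s)
    have h1 : w t x = Real.exp (-l * primitive h t) * (c t x + ∫ s in (0 : ℝ)..t,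
        (Real.exp (l * primitive h s) * h s) * 𝒱.V t s (G (w s)) x) := by
      have h2 := congrArg (Cb.eval x) (hwt t ht)
      rw [map_smul, map_add, ← ContinuousLinearMap.intervalIntegral_comp_comm _ hI] at h2
      simpa only [map_smul, smul_eq_mul, Cb.eval_apply] using h2
    have hV : ∀ s ∈ Set.Ioo 0 t, 0 ≤ 𝒱.V t s (G (w s)) x ∧ 𝒱.V t s (G (w s)) x ≤ l * M := by
      intro s hs
      have hr := sub_pos.2 (timeChange_lt hβ hs.1.le hs.2)
      rw [h𝒱, heatEvolution_apply hα0 hα2 hβ hs.1.le hs.2]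
      refine ⟨integral_nonneg fun y => mul_nonneg (heatKernel_nonneg hα0 hα2 hr _) (hγ _).1,
        (le_abs_self _).trans (abs_heatConv_le hα0 hα2 hr (.of_forall fun y => ?_) x)⟩
      rw [hGx, abs_of_nonneg (hγ _).1]
      exact (hγ _).2
    have hne : ∀ᵐ s : ℝ, s ≠ t := by simp [ae_iff]
    have hIx : IntervalIntegrable (fun s => (Real.exp (l * primitive h s) * h s) *
        𝒱.V t s (G (w s)) x) volume 0 t :=
      ⟨(Cb.eval x).integrable_comp hI.1, (Cb.eval x).integrable_comp hI.2⟩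
    have h3 : 0 ≤ ∫ s in (0 : ℝ)..t, (Real.exp (l * primitive h s) * h s) *
        𝒱.V t s (G (w s)) x := by
      rw [intervalIntegral.integral_of_le ht.le, integral_Ioc_eq_integral_Ioo]
      exact setIntegral_nonneg measurableSet_Ioo fun s hs =>
        mul_nonneg (mul_nonneg (Real.exp_pos _).le (hpos s hs.1).le) (hV s hs).1
    have h4 : ∫ s in (0 : ℝ)..t, (Real.exp (l * primitive h s) * h s) * 𝒱.V t s (G (w s)) x
        ≤ (Real.exp (l * primitive h t) - 1) * M := by
      calc _ ≤ ∫ s in (0 : ℝ)..t, (Real.exp (l * primitive h s) * h s) * (l * M) := by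
            rw [intervalIntegral.integral_of_le ht.le, intervalIntegral.integral_of_le ht.le,
              integral_Ioc_eq_integral_Ioo, integral_Ioc_eq_integral_Ioo]
            refine setIntegral_mono_on (hIx.1.mono_set Set.Ioo_subset_Ioc_self)
              ((hki.mul_const _).1.mono_set Set.Ioo_subset_Ioc_self) measurableSet_Ioo fun s hs => ?_
            exact mul_le_mul_of_nonneg_left (hV s hs).2
              (mul_nonneg (Real.exp_pos _).le (hpos s hs.1).le)
        _ = (Real.exp (l * primitive h t) - 1) * M := by
            rw [intervalIntegral.integral_mul_const, integral_exp_mul hint ht.le hl0]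
            field_simp
    have h5 : Real.exp (-l * primitive h t) * Real.exp (l * primitive h t) = 1 := by
      rw [← Real.exp_add]; simp
    have h6 := Real.exp_pos (-l * primitive h t)
    obtain ⟨h7, h8⟩ := hcx t ht x
    rw [h1]
    refine ⟨by positivity, ?_⟩
    calc _ ≤ Real.exp (-l * primitive h t) * (M + (Real.exp (l * primitive h t) - 1) * M) := by
          gcongr
      _ = M := by linear_combination M * h5
  have hwM : ∀ t, 0 < t → ‖w t‖ ≤ M := fun t ht => Cb.norm_le hM fun x => by
    rw [abs_of_nonneg (hwx t ht x).1]; exact (hwx t ht x).2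
  -- As w takes values in [0, M], the truncation is inactive and l w - G(w) is the power of w.
  refine ⟨w, fun s => l • w s - G (w s), hw, (hw.const_smul l).sub hGw, fun t ht x => ?_, hwx,
    fun t ht => ?_⟩
  · rw [Cb.sub_apply, Cb.smul_apply, hGx, shiftedPow_of_mem (hwx t ht x).1 (hwx t ht x).2]
    ring
  · rw [mild_of_shifted_mild 𝒱 hint hcV hGw (fun s _ => hGB (w s)) hw hwM hwt ht, sub_eq_add_neg,
      ← intervalIntegral.integral_neg]
    congr 1
    refine intervalIntegral.integral_congr fun s _ => ?_
    simp only
    rw [← smul_neg, ← map_neg, neg_sub]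

end MixedHeat

/-! ### The trajectory in `L^∞` and its continuity at time 0. -/

namespace MixedHeat

variable {N : ℕ} {α β p : ℝ} {h : ℝ → ℝ}

local notation "E" => EuclideanSpace ℝ (Fin N)

/-- The set where |g| exceeds ‖f‖ is open and null, hence empty. -/
theorem abs_le_norm_of_ae_eq {f : LInf N} {g : E → ℝ} (hg : Continuous g)
    (hfg : (f : E → ℝ) =ᵐ[volume] g) (x : E) : |g x| ≤ ‖f‖ := by
  have h1 : volume {x : E | ‖f‖ < |g x|} = 0 := by
    refine measure_mono_null (t := {x : E | ¬ |g x| ≤ ‖f‖}) (fun x hx => not_le.2 hx) ?_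
    rw [← ae_iff]
    filter_upwards [hfg, ae_abs_le_norm f] with x h1 h2
    rwa [← h1]
  have h2 : IsOpen {x : E | ‖f‖ < |g x|} := isOpen_lt continuous_const hg.abs
  by_contra hx
  exact (Set.eq_empty_iff_forall_notMem.1 ((h2.measure_eq_zero_iff volume).1 h1) x) (not_le.1 hx)

theorem tendsto_primitive_zero (hint : ∀ T : ℝ, 0 < T → IntegrableOn h (Set.Ioc 0 T)) :
    Filter.Tendsto (primitive h) (nhdsWithin 0 (Set.Ioi 0)) (nhds 0) := by
  have h1 := (primitive_absolutelyContinuous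
    (intervalIntegrable_of_integrableOn hint zero_le_one)).continuousOn
  rw [Set.uIcc_of_le zero_le_one] at h1
  have h2 : Filter.Tendsto (primitive h) (nhdsWithin 0 (Set.Icc 0 1)) (nhds (primitive h 0)) :=
    h1 0 ⟨le_rfl, zero_le_one⟩
  have h3 : primitive h 0 = 0 := intervalIntegral.integral_same
  rw [h3] at h2
  exact h2.mono_left (nhdsWithin_le_of_mem (Filter.mem_of_superset
    (Ioo_mem_nhdsGT zero_lt_one) Set.Ioo_subset_Icc_self))

theorem tendsto_timeChange_zero (hβ : 0 ≤ β) :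
    Filter.Tendsto (timeChange β) (nhdsWithin 0 (Set.Ioi 0)) (nhdsWithin 0 (Set.Ioi 0)) := by
  refine tendsto_nhdsWithin_iff.2 ⟨?_, ?_⟩
  · have h1 := (continuous_timeChange hβ).tendsto 0
    rw [timeChange_zero hβ] at h1
    exact h1.mono_left nhdsWithin_le_nhds
  · filter_upwards [self_mem_nhdsWithin] with t ht using timeChange_pos hβ ht

open Classical in
/-- The trajectory in `L^∞` with initial value `u₀` and values `w t` at positive times. -/
noncomputable def trajectory (u₀ : LInf N) (w : ℝ → Cb N) (t : ℝ) : LInf N :=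
  if 0 < t then bcfToLInf (w t) else u₀

theorem trajectory_of_pos (u₀ : LInf N) (w : ℝ → Cb N) {t : ℝ} (ht : 0 < t) :
    trajectory u₀ w t = bcfToLInf (w t) := if_pos ht

theorem trajectory_zero (u₀ : LInf N) (w : ℝ → Cb N) : trajectory u₀ w 0 = u₀ :=
  if_neg (lt_irrefl _)

theorem continuousOn_trajectory (u₀ : LInf N) {w : ℝ → Cb N} (hw : ContinuousOn w (Set.Ioi 0)) :
    ContinuousOn (trajectory u₀ w) (Set.Ioi 0) :=
  (bcfToLInf.continuous.comp_continuousOn hw).congr fun _ ht => trajectory_of_pos u₀ w ht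

theorem trajectory_bounds {u₀ : LInf N} (hu₀ : 0 ≤ u₀) {w : ℝ → Cb N}
    (hwx : ∀ t, 0 < t → ∀ x, 0 ≤ w t x ∧ w t x ≤ ‖u₀‖) (t : ℝ) :
    0 ≤ trajectory u₀ w t ∧ ‖trajectory u₀ w t‖ ≤ ‖u₀‖ := by
  by_cases ht : 0 < t
  · rw [trajectory_of_pos u₀ w ht]
    refine ⟨(Lp.coeFn_nonneg _).1 ?_, norm_le_of_ae_abs_le (norm_nonneg _) ?_⟩
    · filter_upwards [coeFn_bcfToLInf (w t)] with x hx
      rw [hx]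
      exact (hwx t ht x).1
    · filter_upwards [coeFn_bcfToLInf (w t)] with x hx
      rw [hx, abs_of_nonneg (hwx t ht x).1]
      exact (hwx t ht x).2
  · have h1 : trajectory u₀ w t = u₀ := if_neg ht
    rw [h1]
    exact ⟨hu₀, le_rfl⟩

section Solution

variable (hN : 1 ≤ N) (hα0 : 0 < α) (hα2 : α < 2) (hβ : 0 ≤ β) (hp : 1 < p)
  (hint : ∀ T : ℝ, 0 < T → IntegrableOn h (Set.Ioc 0 T))
  {u₀ : LInf N} {w f : ℝ → Cb N} {B : ℝ}
  (hf : ContinuousOn f (Set.Ioi 0)) (hfB : ∀ t, 0 < t → ‖f t‖ ≤ B)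
  (hfx : ∀ t, 0 < t → ∀ x, f t x = signedPow p (w t x))
  (hwt : ∀ t, 0 < t → w t = heatOp hα0 hα2 (timeChange β t) u₀
        - ∫ s in (0 : ℝ)..t, h s • (heatEvolution N hα0 hα2 hβ).V t s (f s))

include hN hfx in
theorem duhamelIntegrand_trajectory {s t : ℝ} (hs : 0 < s) (hst : s < t) (x : E) :
    duhamelIntegrand N α β p h (trajectory u₀ w) t s x
      = h s * (heatEvolution N hα0 hα2 hβ).V t s (f s) x := by
  rw [duhamelIntegrand_eq hN hα0 hβ _ hs.le hst, heatEvolution_apply hα0 hα2 hβ hs.le hst]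
  congr 1
  refine heatConv_congr ?_ x
  rw [trajectory_of_pos u₀ w hs]
  filter_upwards [coeFn_bcfToLInf (w s)] with y hy
  rw [hy, hfx s hs]

include hN hfx in
-- The equality may fail at s = t, where `semigroup` is the identity while `heatOp` takes its
-- default value 0; a single time is negligible.
theorem duhamelIntegrand_trajectory_ae {t : ℝ} (ht : 0 < t) (x : E) :
    (fun s => Cb.eval x (h s • (heatEvolution N hα0 hα2 hβ).V t s (f s)))
      =ᵐ[volume.restrict (Set.uIoc 0 t)]
      fun s => duhamelIntegrand N α β p h (trajectory u₀ w) t s x := by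
  have hne : ∀ᵐ s : ℝ, s ≠ t := by simp [ae_iff]
  filter_upwards [ae_restrict_of_ae hne, ae_restrict_mem measurableSet_uIoc] with s hst hs
  rw [Set.uIoc_of_le ht.le] at hs
  rw [duhamelIntegrand_trajectory hN hα0 hα2 hβ hfx hs.1 (lt_of_le_of_ne hs.2 hst), map_smul,
    smul_eq_mul, Cb.eval_apply]

include hint hf hfB in
theorem intervalIntegrable_duhamel {t : ℝ} (ht : 0 < t) :
    IntervalIntegrable (fun s => h s • (heatEvolution N hα0 hα2 hβ).V t s (f s)) volume 0 t :=
  (heatEvolution N hα0 hα2 hβ).intervalIntegrable ht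
    (intervalIntegrable_of_integrableOn hint ht.le) hf hfB

include hN hint hf hfB hfx hwt in
theorem isGlobalMildSolution_trajectory (hw : ContinuousOn w (Set.Ioi 0)) (hu₀ : 0 ≤ u₀)
    (hwx : ∀ t, 0 < t → ∀ x, 0 ≤ w t x ∧ w t x ≤ ‖u₀‖) :
    IsGlobalMildSolution N α β p h u₀ (trajectory u₀ w) := by
  intro T hT
  have hIx : ∀ t, 0 < t → ∀ x : E, IntervalIntegrable
      (fun s => duhamelIntegrand N α β p h (trajectory u₀ w) t s x) volume 0 t := by
    intro t ht x
    have hI := intervalIntegrable_duhamel (N := N) hα0 hα2 hβ hint hf hfB ht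
    have h1 : IntervalIntegrable (fun s => Cb.eval x
        (h s • (heatEvolution N hα0 hα2 hβ).V t s (f s))) volume 0 t :=
      ⟨(Cb.eval x).integrable_comp hI.1, (Cb.eval x).integrable_comp hI.2⟩
    exact h1.congr_ae (duhamelIntegrand_trajectory_ae hN hα0 hα2 hβ hfx ht x)
  refine ⟨?_, ⟨‖u₀‖, fun t _ => (trajectory_bounds hu₀ hwx t).2⟩, fun t ht => ?_, fun t ht => ?_⟩
  · rw [← Measure.restrict_congr_set Ioc_ae_eq_Icc]
    exact ((continuousOn_trajectory u₀ hw).mono fun s hs => hs.1).aestronglyMeasurable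
      measurableSet_Ioc
  · rcases ht.1.eq_or_lt with rfl | ht0
    · exact .of_forall fun x => IntervalIntegrable.refl
    · exact .of_forall fun x => hIx t ht0 x
  · rcases ht.1.eq_or_lt with rfl | ht0
    · refine .of_forall fun x => ?_
      rw [intervalIntegral.integral_same, trajectory_zero, timeChange_zero hβ, semigroup,
        if_pos rfl, sub_zero]
    · rw [trajectory_of_pos u₀ w ht0]
      filter_upwards [coeFn_bcfToLInf (w t)] with x hx
      have hI := intervalIntegrable_duhamel (N := N) hα0 hα2 hβ hint hf hfB ht0
      -- Evaluation at x commutes with the Bochner integral in `Cb`, which yields the pointwise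
      -- Duhamel formula.
      rw [hx, ← Cb.eval_apply, hwt t ht0, map_sub,
        ← ContinuousLinearMap.intervalIntegral_comp_comm _ hI, Cb.eval_apply,
        heatOp_apply _ _ (timeChange_pos hβ ht0),
        semigroup_eq_heatConv hN hα0 (timeChange_pos hβ ht0)]
      congr 1
      refine intervalIntegral.integral_congr_ae_restrict ?_
      exact duhamelIntegrand_trajectory_ae hN hα0 hα2 hβ hfx ht0 x

include hint hfB hwt in
-- Near 0 the Duhamel term is at most B H(t), which vanishes for arbitrary data; uniform continuity
-- of g serves only for the convergence S(τ(t)) g → g.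
theorem continuousOn_Ici_trajectory (hpos : ∀ t : ℝ, 0 < t → 0 < h t)
    (hw : ContinuousOn w (Set.Ioi 0))
    {g : E → ℝ} (hg : UniformContinuous g) (hu₀g : (u₀ : E → ℝ) =ᵐ[volume] g) :
    ContinuousOn (trajectory u₀ w) (Set.Ici 0) := by
  have hpos' := continuousOn_trajectory u₀ hw
  intro t ht
  rcases (show (0 : ℝ) ≤ t from ht).eq_or_lt with rfl | ht0
  swap
  · exact (hpos'.continuousAt (Ioi_mem_nhds ht0)).continuousWithinAt
  rw [← continuousWithinAt_Ioi_iff_Ici, Metric.continuousWithinAt_iff'] 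
  intro ε hε
  rw [trajectory_zero]
  have h1 := (tendsto_timeChange_zero hβ).eventually (exists_forall_abs_heatConv_sub_le hα0 hα2 hg
    (abs_le_norm_of_ae_eq hg.continuous hu₀g) (by positivity : (0 : ℝ) < ε / 3))
  have h2 := (tendsto_primitive_zero hint).mul_const B
  rw [zero_mul] at h2
  filter_upwards [h1, h2.eventually_le_const (by positivity : (0 : ℝ) < ε / 3),
    self_mem_nhdsWithin] with t h3 h4 ht
  have ht : 0 < t := ht
  have hτ := timeChange_pos hβ ht
  have h5 := (heatEvolution N hα0 hα2 hβ).norm_integral_le (b := fun _ => B) ht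
    (fun s hs => (hpos s hs).le)
    ((intervalIntegrable_of_integrableOn hint ht.le).mul_const B) hfB
  rw [intervalIntegral.integral_mul_const] at h5
  rw [dist_eq_norm, trajectory_of_pos u₀ w ht]
  refine lt_of_le_of_lt (norm_le_of_ae_abs_le (C := ε / 3 + ε / 3) (by positivity) ?_)
    (by linarith)
  filter_upwards [Lp.coeFn_sub (bcfToLInf (w t)) u₀, coeFn_bcfToLInf (w t), hu₀g] with x e1 e2 e3
  rw [e1, Pi.sub_apply, e2, e3, hwt t ht, Cb.sub_apply, heatOp_apply _ _ hτ,
    heatConv_congr hu₀g, sub_right_comm]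
  refine (abs_sub _ _).trans (add_le_add (h3 x) ?_)
  exact (Cb.abs_coe_le_norm _ x).trans (h5.trans h4)

end Solution

end MixedHeat

theorem theorem2p2 (N : ℕ) (hN : 1 ≤ N) (α β p : ℝ) (hα0 : 0 < α) (hα2 : α < 2)
    (hβ : 0 ≤ β) (hp : 1 < p) (h : ℝ → ℝ) (hpos : ∀ t : ℝ, 0 < t → 0 < h t)
    (hint : ∀ T : ℝ, 0 < T → MeasureTheory.IntegrableOn h (Set.Ioc 0 T))
    (u₀ : MixedHeat.LInf N) (hu₀ : 0 ≤ u₀) :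
    ∃ u : ℝ → MixedHeat.LInf N,
      MixedHeat.IsGlobalMildSolution N α β p h u₀ u ∧
      (∀ t : ℝ, 0 ≤ t → 0 ≤ u t ∧ ‖u t‖ ≤ ‖u₀‖) ∧
      ContinuousOn u (Set.Ioi 0) ∧
      (∀ g : EuclideanSpace ℝ (Fin N) → ℝ, UniformContinuous g →
        (u₀ : EuclideanSpace ℝ (Fin N) → ℝ) =ᵐ[MeasureTheory.volume] g →
          ContinuousOn u (Set.Ici 0)) ∧
      (∀ T : ℝ, 0 < T → ∀ v : ℝ → MixedHeat.LInf N,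
        MixedHeat.IsMildSolution N α β p h u₀ T v → ∀ t ∈ Set.Icc 0 T, v t = u t) := by
  obtain ⟨w, f, hw, hf, hfx, hwx, hwt⟩ :=
    MixedHeat.exists_continuous_solution hα0 hα2 hβ hp hpos hint u₀ hu₀
  have hfB : ∀ t, 0 < t → ‖f t‖ ≤ p * ‖u₀‖ ^ (p - 1) * ‖u₀‖ := fun t ht =>
    MixedHeat.Cb.norm_le (mul_nonneg (mul_nonneg (by linarith)
      (Real.rpow_nonneg (norm_nonneg _) _)) (norm_nonneg _)) fun x => by
        rw [hfx t ht]
        refine MixedHeat.abs_signedPow_le hp ?_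
        rw [abs_of_nonneg (hwx t ht x).1]
        exact (hwx t ht x).2
  have hsol := MixedHeat.isGlobalMildSolution_trajectory hN hα0 hα2 hβ hint hf hfB hfx hwt hw hu₀
    hwx
  exact ⟨MixedHeat.trajectory u₀ w, hsol, fun t _ => MixedHeat.trajectory_bounds hu₀ hwx t,
    MixedHeat.continuousOn_trajectory u₀ hw,
    fun g hg hu₀g => MixedHeat.continuousOn_Ici_trajectory hα0 hα2 hβ hint hfB hwt hpos hw hg hu₀g,
    fun T hT v hv => MixedHeat.IsMildSolution.unique hN hα0 hα2 hβ hp hpos hint hT (hsol T hT) hv⟩
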